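/- Let $n\ge 1$, let $E_{ij}$ be the matrix units of $\mathfrak{gl}_n=\mathfrak{gl}_n(\mathbb C)$, let $\lambda=(\lambda_1,\dots,\lambda_n)\in\mathbb C^n$ with $\lambda_i-\lambda_{i+1}\in\mathbb Z_{\ge 0}$ for all $i<n$, and let $L(\lambda)$ be the finite-dimensional irreducible $\mathfrak{gl}_n$-module with highest weight $\lambda$. Thus $L(\lambda)$ contains a vector $v_\lambda\neq0$ with $E_{ij}v_\lambda=0$ for $i<j$ and $E_{ii}v_\lambda=\lambda_i v_\lambda$; fix such a vector. A Gelfand–Tsetlin pattern associated with $\lambda$ is an array $\Lambda=(\lambda_{ki})_{1\le i\le k\le n}$ of complex numbers with $\lambda_{ni}=\lambda_i$ for $1\le i\le n$, and with $\lambda_{ki}-\lambda_{k-1,i}\in\mathbb Z_{\ge0}$ and $\lambda_{k-1,i}-\lambda_{k,i+1}\in\mathbb Z_{\ge0}$ for $1\le i<k\le n$. For $1\le i<j\le n$ let $$p_{ij}=1+\sum_{r\ge1}E_{ji}^{\,r}E_{ij}^{\,r}\,\frac{(-1)^r}{r!\,\prod_{t=1}^{r}(E_{ii}-E_{jj}+j-i+t)},$$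 let $p^{(m)}=p_{12}p_{13}\cdots p_{1m}\,p_{23}\cdots p_{2m}\cdots p_{m-1,m}$ be the extremal projector of $\mathfrak{gl}_m=\langle E_{ij}\mid 1\le i,j\le m\rangle$, and for $1\le i<k\le n$ let $$z_{ki}=p^{(k-1)}E_{ki}\,(h_i-h_{i+1})\cdots(h_i-h_{k-1}),\qquad h_i=E_{ii}-i+1,$$ be the lowering operators; a fraction with denominator in the elements $E_{ii}-E_{jj}$ acts on a vector of weight $\nu$ through the substitution $E_{ii}\mapsto\nu_i$ (all denominators that occur in the next formula are nonzero). The vectors of the Gelfand–Tsetlin basis of $L(\lambda)$ are $$\xi_\Lambda=\prod_{k=2,\dots,n}^{\longrightarrow}\Bigl(z_{k1}^{\lambda_{k1}-\lambda_{k-1,1}}\cdots z_{k,k-1}^{\lambda_{k,k-1}-\lambda_{k-1,k-1}}\Bigr)v_\lambda .$$ For every pattern $\Lambda$ associated with $\lambda$ put $$\pi_\Lambda=E_{21}^{\lambda_{21}-\lambda_{11}}\,E_{31}^{\lambda_{31}-\lambda_{21}}E_{32}^{\lambda_{32}-\lambda_{22}}\cdots E_{n1}^{\lambda_{n1}-\lambda_{n-1,1}}\cdots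 E_{n,n-1}^{\lambda_{n,n-1}-\lambda_{n-1,n-1}}\,v_\lambda .$$ Then there is a total order $\succcurlyeq$ on the set of all patterns associated with $\lambda$ such that for every pattern $\Lambda$ $$\xi_\Lambda=\sum_{\Lambda'\succcurlyeq\Lambda}d_{\Lambda,\Lambda'}\,\pi_{\Lambda'}$$ with $d_{\Lambda,\Lambda'}\in\mathbb C$ and $d_{\Lambda,\Lambda}\neq0$. In particular, the vectors $\pi_\Lambda$, where $\Lambda$ runs over all patterns associated with $\lambda$, form a basis of $L(\lambda)$. -/

import Mathlib

attribute [local instance 100] LieRing.ofAssociativeRing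

noncomputable section

namespace GelfandTsetlin

open Polynomial

/-- The general linear Lie algebra `𝔤𝔩ₙ` over `ℂ`. Rows and columns are numbered from `0`. -/
abbrev gl (n : ℕ) : Type := Matrix (Fin n) (Fin n) ℂ

/-- The set `ℤ₊ = {0, 1, 2, …}` inside `ℂ`. -/
def IsNat (z : ℂ) : Prop := ∃ m : ℕ, z = (m : ℂ)

/-- The natural number represented by a complex number satisfying `IsNat`. -/
def toNat (z : ℂ) : ℕ := ⌊z.re⌋₊

theorem natCast_toNat {z : ℂ} (hz : IsNat z) : ((toNat z : ℕ) : ℂ) = z := by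
  obtain ⟨m, rfl⟩ := hz
  simp [toNat]

/-- `λᵢ - λᵢ₊₁ ∈ ℤ₊` for all `i`. -/
def IsDominant {n : ℕ} (lam : Fin n → ℂ) : Prop :=
  ∀ i j : Fin n, (i : ℕ) + 1 = j → IsNat (lam i - lam j)

/-- Gelfand–Tsetlin patterns associated with `lam`. With numbering from `0`, the row `k` has the
entries `entry k i`, `i ≤ k`; the unused places `i > k` of the array are filled with zeros. -/
@[ext]
structure Pattern {n : ℕ} (lam : Fin n → ℂ) where
  entry : Fin n → Fin n → ℂ
  zeros : ∀ k i : Fin n, k < i → entry k i = 0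
  top : ∀ k i : Fin n, (k : ℕ) + 1 = n → entry k i = lam i
  between : ∀ k l i j : Fin n, (l : ℕ) + 1 = k → (i : ℕ) + 1 = j → j ≤ k →
    IsNat (entry k i - entry l i) ∧ IsNat (entry l i - entry k j)

/-- The difference of the entries in position `i` of the row `k` and of the next shorter row;
used for `i < k` only. -/
def Pattern.diff {n : ℕ} {lam : Fin n → ℂ} (P : Pattern lam) (k i : Fin n) : ℕ :=
  toNat (P.entry k i - P.entry ⟨(k : ℕ) - 1, by omega⟩ i)

theorem Pattern.natCast_diff {n : ℕ} {lam : Fin n → ℂ} (P : Pattern lam) {k i : Fin n}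
    (hik : i < k) :
    ((P.diff k i : ℕ) : ℂ) = P.entry k i - P.entry ⟨(k : ℕ) - 1, by omega⟩ i := by
  have h1 : (i : ℕ) < k := hik
  refine natCast_toNat (P.between k ⟨(k : ℕ) - 1, by omega⟩ i ⟨(i : ℕ) + 1, by omega⟩ ?_ rfl ?_).1
  · simp only
    omega
  · rw [Fin.le_def]
    simp only
    omega

/-- The ordered product of `f k i` over all pairs `i < k`, the factors being written from left to
right as `f 1 0, f 2 0, f 2 1, …, f (n-1) 0, …, f (n-1) (n-2)`. -/
def orderedProd {n : ℕ} {M : Type*} [Monoid M] (f : Fin n → Fin n → M) : M :=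
  ((List.finRange n).map fun k : Fin n =>
    (((List.finRange n).filter fun i : Fin n => i < k).map fun i => f k i).prod).prod

section Operators

variable {n : ℕ} (V : Type*) [AddCommGroup V] [Module ℂ V] [LieRingModule (gl n) V]
  [LieModule ℂ (gl n) V]

/-- The matrix unit `E_{ij}` acting on the module `V`. -/
def E (i j : Fin n) : Module.End ℂ V :=
  LieModule.toEnd ℂ (gl n) V (Matrix.single i j (1 : ℂ))

/-- `h_i = E_{ii} - i + 1`; the shift becomes `- i` because rows are numbered from `0`. -/
def h (i : Fin n) : Module.End ℂ V := E V i i - ((i : ℕ) : ℂ) • 1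

end Operators

/-- The function `φ` of a diagonalizable operator `T` on a finite-dimensional space: it acts as
`φ c` on the eigenspace of `T` with the eigenvalue `c`. -/
def applyFun {V : Type*} [AddCommGroup V] [Module ℂ V] (T : Module.End ℂ V) (φ : ℂ → ℂ) :
    Module.End ℂ V :=
  aeval T (Lagrange.interpolate (minpoly ℂ T).roots.toFinset id φ)

theorem applyFun_apply {V : Type*} [AddCommGroup V] [Module ℂ V] [FiniteDimensional ℂ V]
    (T : Module.End ℂ V) (φ : ℂ → ℂ) {c : ℂ} {v : V} (hv : T v = c • v) :
    applyFun T φ v = φ c • v := by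
  by_cases h0 : v = 0
  · simp [h0]
  have he : Module.End.HasEigenvector T c v :=
    ⟨Module.End.mem_eigenspace_iff.2 hv, h0⟩
  have hr : c ∈ (minpoly ℂ T).roots.toFinset := by
    rw [Multiset.mem_toFinset, mem_roots (minpoly.ne_zero (Algebra.IsIntegral.isIntegral T))]
    exact Module.End.isRoot_of_hasEigenvalue (Module.End.hasEigenvalue_of_hasEigenvector he)
  rw [applyFun, Module.End.aeval_apply_of_hasEigenvector he]
  congr 1
  exact Lagrange.eval_interpolate_at_node (v := id) φ (Set.injOn_id _) hr

section Projector

variable {n : ℕ} (V : Type*) [AddCommGroup V] [Module ℂ V] [LieRingModule (gl n) V]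
  [LieModule ℂ (gl n) V]

/-- The factor `p_α = 1 + ∑_{r ≥ 1} f_α^r e_α^r (-1)^r / (r! (h_α + ρ(h_α) + 1) ⋯ (h_α + ρ(h_α) + r))`
of the extremal projector for the positive root `α = ε_i - ε_j`, `i < j`, where `e_α = E_{ij}`,
`f_α = E_{ji}`, `h_α = E_{ii} - E_{jj}` and `ρ(h_α) = j - i`. The terms with `r > dim V` vanish,
because `e_α` is nilpotent on a finite-dimensional module. -/
def rootProj (i j : Fin n) : Module.End ℂ V :=
  1 + ∑ r ∈ Finset.Icc 1 (Module.finrank ℂ V),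
    E V j i ^ r * E V i j ^ r *
      applyFun (E V i i - E V j j) fun c =>
        (-1) ^ r / ((r.factorial : ℂ) *
          ∏ t ∈ Finset.Icc 1 r, (c + (((j : ℕ) : ℂ) - ((i : ℕ) : ℂ)) + (t : ℂ)))

/-- The extremal projector associated with the subalgebra `𝔤𝔩ₘ` of `𝔤𝔩ₙ` spanned by the `E_{ij}`
with `i, j < m`: the product of the `p_α` in the lexicographic order
`p_{01} p_{02} ⋯ p_{0,m-1} p_{12} ⋯ p_{m-2,m-1}`, which is a normal order on the positive roots. -/
def extremalProj (m : ℕ) : Module.End ℂ V :=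
  ((List.finRange n).map fun i : Fin n =>
    (((List.finRange n).filter fun j : Fin n => i < j ∧ (j : ℕ) < m).map fun j =>
      rootProj V i j).prod).prod

/-- The lowering operator `z_{ki} = p E_{ki} (h_i - h_{i+1}) ⋯ (h_i - h_{k-1})`, `i < k`, where `p` is
the extremal projector of the `𝔤𝔩` subalgebra on the indices smaller than `k`. -/
def lowering (k i : Fin n) : Module.End ℂ V :=
  extremalProj (n := n) V (k : ℕ) * E V k i *
    (((List.finRange n).filter fun j : Fin n => i < j ∧ j < k).map fun j => h V i - h V j).prod

variable {V}

/-- `v` is a highest weight vector of weight `lam`. -/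
structure IsHighestWeightVector (lam : Fin n → ℂ) (v : V) : Prop where
  ne_zero : v ≠ 0
  raise : ∀ i j : Fin n, i < j → E V i j v = 0
  weight : ∀ i : Fin n, E V i i v = lam i • v

/-- The vector `ξ_Λ` of the Gelfand–Tsetlin basis: the ordered product of the powers of the lowering
operators applied to the highest weight vector. -/
def gtVector {lam : Fin n → ℂ} (v : V) (P : Pattern lam) : V :=
  orderedProd (fun k i => lowering V k i ^ P.diff k i) v

/-- The monomial vector `π_Λ`. -/
def monomialVector {lam : Fin n → ℂ} (v : V) (P : Pattern lam) : V :=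
  orderedProd (fun k i => E V k i ^ P.diff k i) v

end Projector

end GelfandTsetlin

end

/-! Both halves of the theorem rest on a lexicographic order of exponents in which the longest row
is compared first.

Spanning and triangularity. Let `w` be singular for 𝔤𝔩_{k+1} modulo a stable subspace `N`, and apply
to it monomials in E_{k0}, …, E_{k,k-1}. By `IsGl.apply_row` a raising operator E_{bc} of 𝔤𝔩_k moves
one unit of the exponent from place b to the later place c, which makes the exponent smaller. So
every row monomial is singular for 𝔤𝔩_k modulo `rowBelow`, the part generated by `N` and the smaller
monomials. If its weight does not interlace with that of `w`, an 𝔰𝔩₂ argument puts it inside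
`rowBelow` (`IsSingular.row_mem_rowBelow_self`). Descending through 𝔤𝔩_n ⊃ 𝔤𝔩_{n-1} ⊃ … gives
spanning (`levelHull_le_monoSpan`). In a lowering operator the diagonal factor multiplies the
leading term by a nonzero scalar, and the extremal projector is 1 modulo raised vectors. Hence a row
of lowering operators has the corresponding row monomial as leading term
(`IsSingular.lowering_row`), and the shorter rows preserve the error (`lowering_triangular`).

Independence. No dimension formula is used. After a twist by the trace, λ is a partition, and
`columnVector` is a highest weight vector of weight λ in a product of exterior powers, realized as
functions on words. A positive definite form for which E_{ij} and E_{ji} are adjoint shows that the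
submodule generated by the pair of highest weight vectors contains no (0, y) with y ≠ 0
(`eq_zero_of_mem_pairHull`), so linear relations between monomial vectors carry over to words. A
pattern is encoded by a column-strict tableau, and evaluation of the monomials at these tableaux is
triangular with nonzero diagonal (`monomial_columnVector_eq_zero`, `monomial_columnVector_ne_zero`).
-/

noncomputable section

namespace GelfandTsetlin

/-! ### Subspaces generated under a set of operators -/

section Hull

variable {V : Type*} [AddCommGroup V] [Module ℂ V]

/-- The smallest subspace that contains `S` and is stable under the operators in `Ω`. -/
def hull (Ω : Set (Module.End ℂ V)) (S : Set V) : Submodule ℂ V :=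
  sInf {N | S ⊆ N ∧ ∀ f ∈ Ω, ∀ x ∈ N, f x ∈ N}

theorem subset_hull (Ω : Set (Module.End ℂ V)) (S : Set V) : S ⊆ hull Ω S := fun x hx => by
  simp only [hull, SetLike.mem_coe, Submodule.mem_sInf]
  exact fun N hN => hN.1 hx

theorem hull_le {Ω : Set (Module.End ℂ V)} {S : Set V} {N : Submodule ℂ V} (h1 : S ⊆ N)
    (h2 : ∀ f ∈ Ω, ∀ x ∈ N, f x ∈ N) : hull Ω S ≤ N :=
  sInf_le ⟨h1, h2⟩

theorem apply_mem_hull {Ω : Set (Module.End ℂ V)} {S : Set V} {f : Module.End ℂ V} (hf : f ∈ Ω)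
    {x : V} (hx : x ∈ hull Ω S) : f x ∈ hull Ω S := by
  simp only [hull, Submodule.mem_sInf] at hx ⊢
  exact fun N hN => hN.2 f hf x (hx N hN)

/-- The algebra of all operators that preserve the subspace `N`. -/
def stabilizer (N : Submodule ℂ V) : Subalgebra ℂ (Module.End ℂ V) where
  carrier := {f | ∀ x ∈ N, f x ∈ N}
  mul_mem' := fun hf hg x hx => hf _ (hg x hx)
  one_mem' := fun _ hx => hx
  add_mem' := fun hf hg x hx => N.add_mem (hf x hx) (hg x hx)
  zero_mem' := fun _ _ => N.zero_mem
  algebraMap_mem' := fun r _ hx => N.smul_mem r hx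

theorem mem_stabilizer {N : Submodule ℂ V} {f : Module.End ℂ V} :
    f ∈ stabilizer N ↔ ∀ x ∈ N, f x ∈ N := Iff.rfl

theorem aeval_mem_stabilizer {N : Submodule ℂ V} {f : Module.End ℂ V} (hf : f ∈ stabilizer N)
    (p : Polynomial ℂ) : Polynomial.aeval f p ∈ stabilizer N :=
  Algebra.adjoin_le (Set.singleton_subset_iff.2 hf)
    (Polynomial.aeval_mem_adjoin_singleton ℂ f (p := p))

end Hull

/-! ### Ordered products of powers -/

section PowProd

variable {M : Type*} [Monoid M]

/-- The product `g 0 ^ a 0 * g 1 ^ a 1 * ⋯ * g (m - 1) ^ a (m - 1)`. -/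
def powProd (g : ℕ → M) (m : ℕ) (a : ℕ → ℕ) : M :=
  ((List.range m).map fun i => g i ^ a i).prod

@[simp] theorem powProd_zero (g : ℕ → M) (a : ℕ → ℕ) : powProd g 0 a = 1 := rfl

theorem powProd_succ (g : ℕ → M) (m : ℕ) (a : ℕ → ℕ) :
    powProd g (m + 1) a = powProd g m a * g m ^ a m := by
  simp [powProd, List.range_succ]

theorem powProd_congr {g g' : ℕ → M} {m : ℕ} {a b : ℕ → ℕ} (hg : ∀ i < m, g i = g' i)
    (h : ∀ i < m, a i = b i) : powProd g m a = powProd g' m b := by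
  induction m with
  | zero => rfl
  | succ m ih =>
    rw [powProd_succ, powProd_succ, ih (fun i hi => hg i (by omega)) fun i hi => h i (by omega),
      h m (by omega), hg m (by omega)]

theorem powProd_commute {g : ℕ → M} {m : ℕ} {y : M} (h : ∀ i < m, Commute y (g i)) (a : ℕ → ℕ) :
    Commute y (powProd g m a) := by
  induction m with
  | zero => exact Commute.one_right _
  | succ m ih =>
    rw [powProd_succ]
    exact (ih fun i hi => h i (by omega)).mul_right ((h m (by omega)).pow_right _)

theorem mul_powProd {g : ℕ → M} {m : ℕ} (h : ∀ i < m, ∀ j < m, Commute (g i) (g j)) {j : ℕ}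
    (hj : j < m) (a : ℕ → ℕ) : g j * powProd g m a = powProd g m (a + Pi.single j 1) := by
  induction m with
  | zero => omega
  | succ m ih =>
    rw [powProd_succ, powProd_succ]
    rcases Nat.lt_succ_iff_lt_or_eq.1 hj with hj' | rfl
    · rw [← mul_assoc, ih (fun i hi j hj => h i (by omega) j (by omega)) hj']
      simp [Pi.single_eq_of_ne (show m ≠ j by omega)]
    · rw [← mul_assoc, (powProd_commute (fun i hi => h j hj i (by omega)) a).eq, mul_assoc,
        powProd_congr (b := a + Pi.single j 1) (fun i _ => rfl)
        (fun i hi => by simp [Pi.single_eq_of_ne (show i ≠ j by omega)])]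
      simp [pow_succ']

end PowProd

/-- Induction on the sum of the first `k` entries. The base case allows any values from place `k`
on, since these never enter a row monomial. -/
theorem row_induction {P : (ℕ → ℕ) → Prop} (k : ℕ) (h0 : ∀ a : ℕ → ℕ, (∀ i < k, a i = 0) → P a)
    (hs : ∀ (a : ℕ → ℕ) (j : ℕ), j < k → P a → P (a + Pi.single j 1)) (a : ℕ → ℕ) : P a := by
  obtain ⟨m, hm⟩ : ∃ m, m = ∑ i ∈ Finset.range k, a i := ⟨_, rfl⟩
  induction m generalizing a with
  | zero =>
    exact h0 a fun i hi => by
      have := Finset.sum_eq_zero_iff.1 hm.symm i (Finset.mem_range.2 hi)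
      exact this
  | succ m ih =>
    obtain ⟨j, hj, hj0⟩ : ∃ j < k, a j ≠ 0 := by
      by_contra! hc
      rw [Finset.sum_eq_zero fun i hi => hc i (Finset.mem_range.1 hi)] at hm
      omega
    have ha : a = (a - Pi.single j 1) + Pi.single j 1 := by
      ext i
      by_cases hij : i = j
      · subst hij
        simp
        omega
      · simp [Pi.single_eq_of_ne hij]
    rw [ha]
    refine hs _ j hj (ih _ ?_)
    rw [ha] at hm
    simp only [Pi.add_apply, Finset.sum_add_distrib] at hm
    rw [Finset.sum_pi_single' j 1 (Finset.range k)] at hm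
    simp only [Finset.mem_range, hj, if_true] at hm
    omega

/-! ### Row monomials and their commutation with matrix units -/

section Rows

variable {V : Type*} [AddCommGroup V] [Module ℂ V]

/-- The commutation relations of the matrix units of `𝔤𝔩ₙ`. -/
def IsGl (n : ℕ) (e : ℕ → ℕ → Module.End ℂ V) : Prop :=
  ∀ a b c d, a < n → b < n → c < n → d < n →
    e a b * e c d = e c d * e a b + (if b = c then e a d else 0) - (if d = a then e c b else 0)

theorem IsGl.apply {n : ℕ} {e : ℕ → ℕ → Module.End ℂ V} (he : IsGl n e) {a b c d : ℕ}
    (ha : a < n) (hb : b < n) (hc : c < n) (hd : d < n) (x : V) :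
    e a b (e c d x) = e c d (e a b x) + (if b = c then e a d x else 0)
      - (if d = a then e c b x else 0) := by
  have := congrArg (fun f => f x) (he a b c d ha hb hc hd)
  simp only [Module.End.mul_apply, LinearMap.sub_apply, LinearMap.add_apply] at this
  rw [this]
  split_ifs <;> simp

/-- `N` is stable under the matrix units `e a b` with `lo ≤ a, b < hi` and the diagonal matrix units
`e a a` with `a < hi`. -/
def IsStable (e : ℕ → ℕ → Module.End ℂ V) (lo hi : ℕ) (N : Submodule ℂ V) : Prop :=
  (∀ a b, lo ≤ a → a < hi → lo ≤ b → b < hi → ∀ x ∈ N, e a b x ∈ N) ∧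
    ∀ a < hi, ∀ x ∈ N, e a a x ∈ N

theorem IsStable.mono {e : ℕ → ℕ → Module.End ℂ V} {lo hi lo' hi' : ℕ} {N : Submodule ℂ V}
    (h : IsStable e lo hi N) (h1 : lo ≤ lo') (h2 : hi' ≤ hi) : IsStable e lo' hi' N :=
  ⟨fun a b ha ha' hb hb' => h.1 a b (by omega) (by omega) (by omega) (by omega),
    fun a ha => h.2 a (by omega)⟩

theorem IsStable.sup {e : ℕ → ℕ → Module.End ℂ V} {lo hi : ℕ} {N N' : Submodule ℂ V}
    (h : IsStable e lo hi N) (h' : IsStable e lo hi N') : IsStable e lo hi (N ⊔ N') := by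
  constructor
  · intro a b ha ha' hb hb' x hx
    obtain ⟨y, hy, z, hz, rfl⟩ := Submodule.mem_sup.1 hx
    rw [map_add]
    exact Submodule.add_mem_sup (h.1 a b ha ha' hb hb' y hy) (h'.1 a b ha ha' hb hb' z hz)
  · intro a ha x hx
    obtain ⟨y, hy, z, hz, rfl⟩ := Submodule.mem_sup.1 hx
    rw [map_add]
    exact Submodule.add_mem_sup (h.2 a ha y hy) (h'.2 a ha z hz)

theorem IsStable.iSup {ι : Sort*} {e : ℕ → ℕ → Module.End ℂ V} {lo hi : ℕ}
    {N : ι → Submodule ℂ V} (h : ∀ i, IsStable e lo hi (N i)) : IsStable e lo hi (⨆ i, N i) := by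
  have key : ∀ f : Module.End ℂ V, (∀ i, ∀ x ∈ N i, f x ∈ N i) → ∀ x ∈ ⨆ i, N i, f x ∈ ⨆ i, N i := by
    intro f hf x hx
    have : (⨆ i, N i) ≤ (⨆ i, N i).comap f :=
      iSup_le fun i y hy => Submodule.mem_iSup_of_mem i (hf i y hy)
    exact this hx
  exact ⟨fun a b ha ha' hb hb' => key _ fun i => (h i).1 a b ha ha' hb hb',
    fun a ha => key _ fun i => (h i).2 a ha⟩

/-- The smallest subspace that contains `S` and is stable in the sense of `IsStable e lo hi`. -/
def levelHull (e : ℕ → ℕ → Module.End ℂ V) (lo hi : ℕ) (S : Set V) : Submodule ℂ V :=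
  hull {f | (∃ a b, lo ≤ a ∧ a < hi ∧ lo ≤ b ∧ b < hi ∧ f = e a b) ∨ ∃ a < hi, f = e a a} S

variable {e : ℕ → ℕ → Module.End ℂ V} {lo hi : ℕ} {S : Set V} {N : Submodule ℂ V}

theorem subset_levelHull : S ⊆ levelHull e lo hi S := subset_hull _ _

theorem levelHull_isStable : IsStable e lo hi (levelHull e lo hi S) :=
  ⟨fun a b h1 h2 h3 h4 _ hx => apply_mem_hull (Or.inl ⟨a, b, h1, h2, h3, h4, rfl⟩) hx,
    fun a ha _ hx => apply_mem_hull (Or.inr ⟨a, ha, rfl⟩) hx⟩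

theorem levelHull_le (h1 : S ⊆ N) (h2 : IsStable e lo hi N) : levelHull e lo hi S ≤ N := by
  refine hull_le h1 ?_
  rintro f (⟨a, b, ha, ha', hb, hb', rfl⟩ | ⟨a, ha, rfl⟩)
  · exact h2.1 a b ha ha' hb hb'
  · exact h2.2 a ha

/-- Lexicographic comparison of the first `k` places of `b` and `a`. -/
def RowLt (k : ℕ) (b a : ℕ → ℕ) : Prop := ∃ i < k, b i < a i ∧ ∀ j < i, b j = a j

theorem RowLt.trans {k : ℕ} {a b c : ℕ → ℕ} (h1 : RowLt k a b) (h2 : RowLt k b c) :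
    RowLt k a c := by
  obtain ⟨i, hi, hlt, heq⟩ := h1
  obtain ⟨j, hj, hlt', heq'⟩ := h2
  rcases lt_trichotomy i j with h | rfl | h
  · exact ⟨i, hi, by rw [← heq' i h]; exact hlt,
      fun l hl => (heq l hl).trans (heq' l (by omega))⟩
  · exact ⟨i, hi, hlt.trans hlt', fun l hl => (heq l hl).trans (heq' l hl)⟩
  · exact ⟨j, hj, by rw [heq j h]; exact hlt',
      fun l hl => (heq l (by omega)).trans (heq' l hl)⟩

theorem wellFounded_rowLt (k : ℕ) : WellFounded (RowLt k) := by
  have h : WellFounded (fun x y : Lex (Fin k → ℕ) => x < y) := wellFounded_lt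
  refine Subrelation.wf ?_ (InvImage.wf (fun a : ℕ → ℕ => toLex fun i : Fin k => a i) h)
  rintro b a ⟨i, hi, hlt, heq⟩
  exact ⟨⟨i, hi⟩, fun j hj => heq j hj, hlt⟩

variable {n : ℕ} (he : IsGl n e) {k : ℕ} (hk : k < n)

include he hk

theorem IsGl.row_commute : ∀ i < k, ∀ j < k, Commute (e k i) (e k j) := by
  intro i hi j hj
  have := he k i k j hk (by omega) hk (by omega)
  rwa [if_neg (by omega), if_neg (by omega), add_zero, sub_zero] at this

theorem IsGl.row_mul {j : ℕ} (hj : j < k) (a : ℕ → ℕ) (w : V) :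
    e k j (powProd (e k) k a w) = powProd (e k) k (a + Pi.single j 1) w := by
  rw [← mul_powProd (he.row_commute hk) hj, Module.End.mul_apply]

/-- Matrix units of `𝔤𝔩ₖ` past a monomial in the last row of `𝔤𝔩ₖ₊₁`. -/
theorem IsGl.apply_row {b c : ℕ} (hb : b < k) (hc : c < k) (a : ℕ → ℕ) (w : V) :
    e b c (powProd (e k) k a w) = powProd (e k) k a (e b c w)
      - (a b : ℂ) • powProd (e k) k (a - Pi.single b 1 + Pi.single c 1) w := by
  induction a using row_induction k with
  | h0 a ha =>
    rw [ha b hb, powProd_congr (g' := e k) (b := 0) (fun _ _ => rfl) (by simpa using ha)]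
    simp [powProd]
  | hs a j hj ih =>
    rw [← he.row_mul hk hj, ← he.row_mul hk hj, he.apply (by omega) (by omega) hk (by omega), ih,
      if_neg (by omega), add_zero, map_sub, map_smul, he.row_mul hk hj, he.row_mul hk hj,
      sub_sub]
    congr 1
    by_cases hjb : j = b
    · subst hjb
      rw [if_pos rfl, he.row_mul hk hc]
      have h2 : a + Pi.single j 1 - Pi.single j 1 = a := by
        ext i; simp
      rw [h2]
      simp only [Pi.add_apply, Pi.single_eq_same, Nat.cast_add, Nat.cast_one, add_smul, one_smul]
      congr 1
      -- For `a j = 0` truncated subtraction spoils the identity `h3` of exponents, but the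
      -- coefficient `a j` is then zero.
      by_cases h0 : a j = 0
      · simp [h0]
      have h3 : a - Pi.single j 1 + Pi.single c 1 + Pi.single j 1 = a + Pi.single c 1 := by
        ext i
        by_cases hij : i = j
        · subst hij
          simp
          omega
        · simp [Pi.single_eq_of_ne hij]
      rw [h3]
    · rw [if_neg hjb, add_zero]
      have h1 : (a + Pi.single j 1 : ℕ → ℕ) b = a b := by
        simp [Pi.single_eq_of_ne (Ne.symm hjb)]
      rw [h1]
      have h3 : a - Pi.single b 1 + Pi.single c 1 + Pi.single j 1 =
          a + Pi.single j 1 - Pi.single b 1 + Pi.single c 1 := by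
        ext i
        by_cases hij : i = j
        · subst hij
          simp [Pi.single_eq_of_ne hjb]
          omega
        · simp [Pi.single_eq_of_ne hij]
      rw [h3]

end Rows

/-! ### The lexicographic filtration by row monomials -/

section Filtration

variable {V : Type*} [AddCommGroup V] [Module ℂ V]

/-- `w` is a weight vector of weight `mu` for `𝔤𝔩ₖ`, and its image modulo `N` is singular. -/
structure IsSingular (e : ℕ → ℕ → Module.End ℂ V) (k : ℕ) (N : Submodule ℂ V) (mu : ℕ → ℂ)
    (w : V) : Prop where
  raise : ∀ b c, b < c → c < k → e b c w ∈ N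
  weight : ∀ b < k, e b b w = mu b • w

/-- The span modulo `N` of the `𝔤𝔩`-submodules generated by the monomial vectors
`powProd (e k) k b w` with `b` smaller than `a`; only the indices from `lo` on are used. -/
def rowBelow (e : ℕ → ℕ → Module.End ℂ V) (k : ℕ) (N : Submodule ℂ V) (w : V) (lo : ℕ)
    (a : ℕ → ℕ) : Submodule ℂ V :=
  levelHull e lo k
    (N ∪ {x | ∃ b, RowLt k b a ∧ (∀ i < lo, b i = 0) ∧ x = powProd (e k) k b w})

variable {e : ℕ → ℕ → Module.End ℂ V} {n k lo : ℕ} {N : Submodule ℂ V} {w : V} {a : ℕ → ℕ}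
  {mu : ℕ → ℂ}

theorem rowBelow_isStable : IsStable e lo k (rowBelow e k N w lo a) := levelHull_isStable

theorem le_rowBelow : N ≤ rowBelow e k N w lo a := fun _ hx =>
  subset_levelHull (Or.inl hx)

theorem row_mem_rowBelow {b : ℕ → ℕ} (h : RowLt k b a) (hb : ∀ i < lo, b i = 0) :
    powProd (e k) k b w ∈ rowBelow e k N w lo a :=
  subset_levelHull (Or.inr ⟨b, h, hb, rfl⟩)

theorem rowBelow_mono {lo' : ℕ} {a' : ℕ → ℕ} (hlo : lo' ≤ lo)
    (h : ∀ b, RowLt k b a → RowLt k b a') :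
    rowBelow e k N w lo a ≤ rowBelow e k N w lo' a' := by
  refine levelHull_le ?_ ⟨fun b c h1 h2 h3 h4 => ?_, fun b hb => ?_⟩
  · rintro x (hx | ⟨b, hb, hb', rfl⟩)
    · exact le_rowBelow hx
    · exact row_mem_rowBelow (h b hb) fun i hi => hb' i (by omega)
  · exact rowBelow_isStable.1 b c (by omega) h2 (by omega) h4
  · exact rowBelow_isStable.2 b hb

theorem rowLt_sub_add {b c : ℕ} (hbc : b < c) (hc : c < k) (hb : a b ≠ 0) :
    RowLt k (a - Pi.single b 1 + Pi.single c 1) a := by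
  refine ⟨b, by omega, ?_, fun j hj => ?_⟩
  · simp [Pi.single_eq_of_ne (show b ≠ c by omega)]
    omega
  · simp [Pi.single_eq_of_ne (show j ≠ c by omega), Pi.single_eq_of_ne (show j ≠ b by omega)]

theorem RowLt.add_single {b : ℕ → ℕ} (h : RowLt k b a) {i j : ℕ} (hij : i ≤ j) (hj : j < k) :
    RowLt k (b + Pi.single j 1) (a + Pi.single i 1) := by
  obtain ⟨l, hl, hlt, heq⟩ := h
  rcases lt_or_ge i l with h1 | h1
  · rcases hij.lt_or_eq with h2 | rfl
    · refine ⟨i, by omega, ?_, fun m hm => ?_⟩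
      · simp [Pi.single_eq_of_ne (show i ≠ j by omega), heq i h1]
      · simp [Pi.single_eq_of_ne (show m ≠ j by omega), Pi.single_eq_of_ne (show m ≠ i by omega),
          heq m (by omega)]
    · refine ⟨l, by omega, ?_, fun m hm => ?_⟩
      · simpa [Pi.single_eq_of_ne (show l ≠ i by omega)] using hlt
      · simp [heq m hm]
  · refine ⟨l, hl, ?_, fun m hm => ?_⟩
    · by_cases h2 : l = i
      · subst h2
        by_cases h3 : l = j
        · subst h3
          simpa using hlt
        · simp [Pi.single_eq_of_ne h3]
          omega
      · simpa [Pi.single_eq_of_ne h2, Pi.single_eq_of_ne (show l ≠ j by omega)] using hlt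
    · simp [Pi.single_eq_of_ne (show m ≠ j by omega), Pi.single_eq_of_ne (show m ≠ i by omega),
        heq m hm]

theorem powProd_mem_stabilizer {g : ℕ → Module.End ℂ V} {m : ℕ}
    (h : ∀ i < m, g i ∈ stabilizer N) (a : ℕ → ℕ) : powProd g m a ∈ stabilizer N := by
  induction m with
  | zero => exact one_mem _
  | succ m ih =>
    rw [powProd_succ]
    exact mul_mem (ih fun i hi => h i (by omega)) (pow_mem (h m (by omega)) _)

variable (he : IsGl n e) (hk : k < n) (hN : IsStable e 0 (k + 1) N)
  (hw : IsSingular e (k + 1) N mu w)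

include hN in
theorem IsStable.row_mem {x : V} (hx : x ∈ N) : powProd (e k) k a x ∈ N :=
  powProd_mem_stabilizer (fun i _ => mem_stabilizer.2
    (hN.1 k i (Nat.zero_le _) (by omega) (Nat.zero_le _) (by omega))) a x hx

include he hk hw

theorem IsSingular.row_weight {b : ℕ} (hb : b < k) :
    e b b (powProd (e k) k a w) = (mu b - a b) • powProd (e k) k a w := by
  rw [he.apply_row hk hb hb, hw.weight b (by omega), map_smul, sub_smul]
  congr 1
  by_cases h0 : a b = 0
  · simp [h0]
  congr 3
  ext i
  by_cases hib : i = b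
  · subst hib
    simp
    omega
  · simp [Pi.single_eq_of_ne hib]

include hN

theorem IsSingular.row_raise {b c : ℕ} (hlo : lo ≤ b) (hbc : b < c) (hc : c < k)
    (ha : ∀ i < lo, a i = 0) :
    e b c (powProd (e k) k a w) ∈ rowBelow e k N w lo a := by
  rw [he.apply_row hk (by omega) hc]
  refine Submodule.sub_mem _ (le_rowBelow (hN.row_mem (hw.raise b c hbc (by omega)))) ?_
  by_cases h0 : a b = 0
  · simp [h0]
  refine Submodule.smul_mem _ _ (row_mem_rowBelow (rowLt_sub_add hbc hc h0) fun i hi => ?_)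
  simp [Pi.single_eq_of_ne (show i ≠ c by omega), ha i hi]

theorem IsSingular.row_killed {b c : ℕ} (hlo : b < lo) (hbc : b < c) (hc : c < k)
    (ha : ∀ i < lo, a i = 0) : e b c (powProd (e k) k a w) ∈ N := by
  rw [he.apply_row hk (by omega) hc, ha b hlo]
  simpa using hN.row_mem (hw.raise b c hbc (by omega))

/-- The vectors sent into `N` by all `e b c` with `b < lo` form a subspace stable under the
operators of the hull: the commutator with `e b' c'`, where `b', c' ≥ lo`, is zero or again an
operator `e b c'` of this kind. -/
theorem IsSingular.rowBelow_killed {b c : ℕ} (hlo : b < lo) (hbc : b < c) (hc : c < k) {y : V}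
    (hy : y ∈ rowBelow e k N w lo a) : e b c y ∈ N := by
  let Q : Submodule ℂ V :=
    { carrier := {y | ∀ b c, b < lo → b < c → c < k → e b c y ∈ N}
      add_mem' := fun hx hy b c h1 h2 h3 => by
        rw [map_add]; exact N.add_mem (hx b c h1 h2 h3) (hy b c h1 h2 h3)
      zero_mem' := fun b c _ _ _ => by rw [map_zero]; exact N.zero_mem
      smul_mem' := fun r x hx b c h1 h2 h3 => by
        rw [map_smul]; exact N.smul_mem r (hx b c h1 h2 h3) }
  have hQ : rowBelow e k N w lo a ≤ Q := by
    refine levelHull_le ?_ ⟨fun b' c' h1 h2 h3 h4 x hx b c hb hbc hc => ?_,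
      fun d hd x hx b c hb hbc hc => ?_⟩
    · rintro x (hx | ⟨a', -, ha', rfl⟩) b c hb hbc hc
      · exact hN.1 b c (Nat.zero_le _) (by omega) (Nat.zero_le _) (by omega) x hx
      · exact hw.row_killed he hk hN hb hbc hc ha'
    · rw [he.apply (by omega) (by omega) (by omega) (by omega), if_neg (show ¬ c' = b by omega),
        sub_zero]
      refine N.add_mem (hN.1 _ _ (Nat.zero_le _) (by omega) (Nat.zero_le _) (by omega) _
        (hx b c hb hbc hc)) ?_
      split_ifs
      · exact hx b c' hb (by omega) h4
      · exact N.zero_mem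
    · rw [he.apply (by omega) (by omega) (by omega) (by omega)]
      refine N.sub_mem (N.add_mem (hN.2 _ (by omega) _ (hx b c hb hbc hc)) ?_) ?_
      · split_ifs with h
        · subst h; exact hx b c hb hbc hc
        · exact N.zero_mem
      · split_ifs with h
        · subst h; exact hx d c hb hbc hc
        · exact N.zero_mem
  exact hQ hy b c hlo hbc hc

-- This is the reason for the parameter `lo`. Commuting `e k j` past `e b c` produces `e k c`, and
-- multiplication by it stays below the new exponent only if `c ≥ i`. Hence the hull uses
-- off-diagonal units with indices from `i` on only.
omit hw in
theorem row_apply_rowBelow {i j : ℕ} (hij : i ≤ j) (hj : j < k) {y : V}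
    (hy : y ∈ rowBelow e k N w i a) : e k j y ∈ rowBelow e k N w i (a + Pi.single i 1) := by
  set F := rowBelow e k N w i (a + Pi.single i 1) with hF
  let Q : Submodule ℂ V :=
    { carrier := {y | ∀ j, i ≤ j → j < k → e k j y ∈ F}
      add_mem' := fun hx hy j h1 h2 => by
        rw [map_add]; exact F.add_mem (hx j h1 h2) (hy j h1 h2)
      zero_mem' := fun j _ _ => by rw [map_zero]; exact F.zero_mem
      smul_mem' := fun r x hx j h1 h2 => by
        rw [map_smul]; exact F.smul_mem r (hx j h1 h2) }
  have hQ : rowBelow e k N w i a ≤ Q := by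
    refine levelHull_le ?_ ⟨fun b c h1 h2 h3 h4 x hx j hij hj => ?_,
      fun d hd x hx j hij hj => ?_⟩
    · rintro x (hx | ⟨b, hb, hb', rfl⟩) j hij hj
      · exact le_rowBelow (hN.1 k j (Nat.zero_le _) (by omega) (Nat.zero_le _) (by omega) x hx)
      · rw [he.row_mul hk hj]
        refine row_mem_rowBelow (hb.add_single hij hj) fun l hl => ?_
        simp [Pi.single_eq_of_ne (show l ≠ j by omega), hb' l hl]
    · rw [he.apply (by omega) (by omega) (by omega) (by omega), if_neg (show ¬ c = k by omega),
        sub_zero]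
      refine F.add_mem (rowBelow_isStable.1 b c h1 h2 h3 h4 _ (hx j hij hj)) ?_
      split_ifs
      · exact hx c h3 h4
      · exact F.zero_mem
    · rw [he.apply (by omega) (by omega) (by omega) (by omega), if_neg (show ¬ d = k by omega),
        sub_zero]
      refine F.add_mem (rowBelow_isStable.2 d hd _ (hx j hij hj)) ?_
      split_ifs with h
      · exact hx d (by omega) hd
      · exact F.zero_mem
  exact hQ hy j hij hj

end Filtration

/-! ### Monomials that violate interlacing -/

section Vanishing

variable {V : Type*} [AddCommGroup V] [Module ℂ V] {e : ℕ → ℕ → Module.End ℂ V} {n k : ℕ}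
  {N : Submodule ℂ V} {w : V} {a : ℕ → ℕ} {mu : ℕ → ℂ}
  (he : IsGl n e) (hk : k < n) (hN : IsStable e 0 (k + 1) N) (hw : IsSingular e (k + 1) N mu w)

include he hk hw

theorem IsSingular.weight_pow {i : ℕ} (hi : i < k) (r : ℕ) :
    e i i ((e (i + 1) i ^ r) w) = (mu i - r) • (e (i + 1) i ^ r) w ∧
    e (i + 1) (i + 1) ((e (i + 1) i ^ r) w) = (mu (i + 1) + r) • (e (i + 1) i ^ r) w := by
  induction r with
  | zero => simp [hw.weight i (by omega), hw.weight (i + 1) (by omega)]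
  | succ r ih =>
    rw [pow_succ', Module.End.mul_apply,
      he.apply (a := i) (b := i) (by omega) (by omega) (by omega) (by omega),
      he.apply (a := i + 1) (b := i + 1) (by omega) (by omega) (by omega) (by omega), ih.1, ih.2]
    simp only [map_smul, if_neg (show ¬ i = i + 1 by omega), if_true]
    push_cast
    constructor <;> module

include hN

/-- Induction on `r` by the 𝔰𝔩₂ relations. The error comes from the raised vector `e i (i + 1) w`,
and it stays in `N` under lowering. -/
theorem IsSingular.raise_pow {i : ℕ} (hi : i < k) (r : ℕ) :
    e i (i + 1) ((e (i + 1) i ^ (r + 1)) w) -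
      ((r + 1) * (mu i - mu (i + 1) - r) : ℂ) • (e (i + 1) i ^ r) w ∈ N := by
  induction r with
  | zero =>
    rw [zero_add, pow_one, pow_zero, he.apply (by omega) (by omega) (by omega) (by omega),
      if_pos rfl, if_pos rfl, Module.End.one_apply, hw.weight i (by omega),
      hw.weight (i + 1) (by omega)]
    have := hN.1 (i + 1) i (Nat.zero_le _) (by omega) (Nat.zero_le _) (by omega) _
      (hw.raise i (i + 1) (by omega) (by omega))
    convert this using 1
    push_cast
    module
  | succ r ih =>
    have h2 := hN.1 (i + 1) i (Nat.zero_le _) (by omega) (Nat.zero_le _) (by omega) _ ih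
    rw [pow_succ', Module.End.mul_apply, he.apply (by omega) (by omega) (by omega) (by omega),
      if_pos rfl, if_pos rfl, (hw.weight_pow he hk hi _).1, (hw.weight_pow he hk hi _).2]
    convert h2 using 1
    rw [map_sub, map_smul, ← Module.End.mul_apply (e (i + 1) i) (e (i + 1) i ^ r), ← pow_succ']
    push_cast
    module

/-- From the power `m + 1` on the scalars of `raise_pow` do not vanish. If this power were outside
`N`, so would be all later ones; they would be nonzero eigenvectors of `e i i` with infinitely many
distinct eigenvalues. -/
theorem IsSingular.lower_pow_mem [FiniteDimensional ℂ V] {i m : ℕ} (hi : i < k)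
    (hm : mu i - mu (i + 1) = m) : (e (i + 1) i ^ (m + 1)) w ∈ N := by
  by_contra hc
  have key : ∀ r, (e (i + 1) i ^ (m + 1 + r)) w ∉ N := by
    intro r
    induction r with
    | zero => exact hc
    | succ r ih =>
      intro h
      apply ih
      rw [← add_assoc] at h
      have h1 := hN.1 i (i + 1) (Nat.zero_le _) (by omega) (Nat.zero_le _) (by omega) _ h
      have h2 := N.sub_mem h1 (hw.raise_pow he hk hN hi (m + 1 + r))
      rw [sub_sub_cancel, hm] at h2
      refine (N.smul_mem_iff ?_).1 h2
      refine mul_ne_zero (Nat.cast_add_one_ne_zero _) ?_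
      push_cast
      rw [show (m : ℂ) - (m + 1 + r) = -((r + 1 : ℕ) : ℂ) by push_cast; ring]
      exact neg_ne_zero.2 (by exact_mod_cast r.succ_ne_zero)
  have hfin := Module.End.finite_hasEigenvalue (e i i)
  refine Set.infinite_of_injective_forall_mem (f := fun r : ℕ => mu i - ((m + 1 + r : ℕ) : ℂ))
    ?_ ?_ hfin
  · intro r s h
    simpa using h
  · intro r
    refine Module.End.hasEigenvalue_of_hasEigenvector (x := (e (i + 1) i ^ (m + 1 + r)) w)
      ⟨Module.End.mem_eigenspace_iff.2 (hw.weight_pow he hk hi _).1, fun h0 => key r ?_⟩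
    rw [h0]
    exact N.zero_mem

/-- Put f = `e (i + 1) i`. For `i + 1 < k` this is an operator of 𝔤𝔩_k. Let `b s` be `a` with `s`
units moved from place `i` to place `i + 1`; applying f to the monomial `b (s + 1)` brings back `b
s` with a positive coefficient. Descent from `b (m + 1)` on f^{m+1} w, which lies in `N`, ends at
`a` on `w`. For `i + 1 = k` the power f^{m+1} itself occurs at the right end of the monomial. -/
theorem IsSingular.row_mem_rowBelow_self [FiniteDimensional ℂ V] {i m : ℕ} (hi : i < k)
    (hm : mu i - mu (i + 1) = m) (ha : m < a i) :
    powProd (e k) k a w ∈ rowBelow e k N w 0 a := by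
  have hf := hw.lower_pow_mem he hk hN hi hm
  rcases Nat.lt_or_ge (i + 1) k with hik | hik
  · set F := rowBelow e k N w 0 a
    let b : ℕ → ℕ → ℕ := fun r => a - r • Pi.single i 1 + r • Pi.single (i + 1) 1
    have hb : ∀ r, r + 1 ≤ a i → b (r + 1) - Pi.single (i + 1) 1 + Pi.single i 1 = b r := by
      intro r hr
      ext l
      by_cases h1 : l = i
      · subst h1
        simp [b]
        omega
      · by_cases h2 : l = i + 1
        · subst h2
          simp [b]
          omega
        · simp [b, Pi.single_eq_of_ne h1, Pi.single_eq_of_ne h2]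
    have step : ∀ (r s : ℕ), s + 1 ≤ a i →
        powProd (e k) k (b (s + 1)) ((e (i + 1) i ^ (r + 1)) w) =
          e (i + 1) i (powProd (e k) k (b (s + 1)) ((e (i + 1) i ^ r) w)) +
          ((a (i + 1) + s + 1 : ℕ) : ℂ) • powProd (e k) k (b s) ((e (i + 1) i ^ r) w) := by
      intro r s hs
      rw [he.apply_row hk hik hi, hb s hs, pow_succ', Module.End.mul_apply]
      have : b (s + 1) (i + 1) = a (i + 1) + s + 1 := by
        simp [b]
        omega
      rw [this, sub_add_cancel]
    have hfF : ∀ x ∈ F, e (i + 1) i x ∈ F :=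
      rowBelow_isStable.1 _ _ (Nat.zero_le _) hik (Nat.zero_le _) hi
    -- With more units moved than powers of f applied, membership reduces to `r = 0`, where `b s` is
    -- lexicographically smaller than `a`.
    have above : ∀ r s, r < s → s ≤ a i → powProd (e k) k (b s) ((e (i + 1) i ^ r) w) ∈ F := by
      intro r
      induction r with
      | zero =>
        intro s hs hs'
        refine row_mem_rowBelow ⟨i, hi, ?_, fun j hj => ?_⟩ fun _ h => absurd h (Nat.not_lt_zero _)
        · simp [b]
          omega
        · simp [b, Pi.single_eq_of_ne (show j ≠ i by omega),
            Pi.single_eq_of_ne (show j ≠ i + 1 by omega)]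
      | succ r ih =>
        intro s hs hs'
        obtain ⟨s, rfl⟩ : ∃ t, s = t + 1 := ⟨s - 1, by omega⟩
        rw [step r s hs']
        exact F.add_mem (hfF _ (ih _ (by omega) hs')) (F.smul_mem _ (ih s (by omega) (by omega)))
    -- In `step s s` the term under f is covered by `above` and the other has a nonzero coefficient,
    -- so membership descends from `s + 1` to `s`.
    have diag : ∀ r, r ≤ m + 1 →
        powProd (e k) k (b (m + 1 - r)) ((e (i + 1) i ^ (m + 1 - r)) w) ∈ F := by
      intro r
      induction r with
      | zero => exact fun _ => le_rowBelow (hN.row_mem hf)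
      | succ r ih =>
        intro hr
        have h1 := ih (by omega)
        obtain ⟨s, hs⟩ : ∃ s, m + 1 - r = s + 1 := ⟨m - r, by omega⟩
        rw [hs, step s s (by omega)] at h1
        rw [show m + 1 - (r + 1) = s by omega]
        have h2 := (F.add_mem_iff_right (hfF _ (above s (s + 1) (by omega) (by omega)))).1 h1
        exact (F.smul_mem_iff (Nat.cast_ne_zero.2 (by omega))).1 h2
    have := diag (m + 1) le_rfl
    simpa [b] using this
  · obtain rfl : k = i + 1 := by omega
    refine le_rowBelow ?_
    rw [powProd_succ, Module.End.mul_apply]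
    refine powProd_mem_stabilizer (fun j _ => mem_stabilizer.2
      (hN.1 _ j (Nat.zero_le _) (by omega) (Nat.zero_le _) (by omega))) a _ ?_
    obtain ⟨r, hr⟩ : ∃ r, a i = r + (m + 1) := ⟨a i - (m + 1), by omega⟩
    rw [hr, pow_add, Module.End.mul_apply]
    have hs : e (i + 1) i ∈ stabilizer N := mem_stabilizer.2
      (hN.1 _ i (Nat.zero_le _) (by omega) (Nat.zero_le _) (by omega))
    exact pow_mem hs r _ hf

end Vanishing

theorem IsNat.add {x y : ℂ} (hx : IsNat x) (hy : IsNat y) : IsNat (x + y) := by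
  obtain ⟨a, rfl⟩ := hx
  obtain ⟨b, rfl⟩ := hy
  exact ⟨a + b, by push_cast; rfl⟩

theorem IsNat.natCast (m : ℕ) : IsNat (m : ℂ) := ⟨m, rfl⟩

/-! ### Arrays of exponents and their admissibility -/

section Arrays

variable {M : Type*} [Monoid M]

/-- The ordered product of the powers `g r i ^ A r i` over all `i < r < k`. -/
def arrProd (g : ℕ → ℕ → M) (k : ℕ) (A : ℕ → ℕ → ℕ) : M :=
  ((List.range k).map fun r => powProd (g r) r (A r)).prod

@[simp] theorem arrProd_zero (g : ℕ → ℕ → M) (A : ℕ → ℕ → ℕ) : arrProd g 0 A = 1 := rfl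

theorem arrProd_succ (g : ℕ → ℕ → M) (k : ℕ) (A : ℕ → ℕ → ℕ) :
    arrProd g (k + 1) A = arrProd g k A * powProd (g k) k (A k) := by
  simp [arrProd, List.range_succ]

theorem arrProd_congr {g g' : ℕ → ℕ → M} {k : ℕ} {A B : ℕ → ℕ → ℕ}
    (hg : ∀ r < k, ∀ i < r, g r i = g' r i) (h : ∀ r < k, ∀ i < r, A r i = B r i) :
    arrProd g k A = arrProd g' k B := by
  induction k with
  | zero => rfl
  | succ k ih =>
    rw [arrProd_succ, arrProd_succ, ih (fun r hr => hg r (by omega)) fun r hr => h r (by omega),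
      powProd_congr (hg k (by omega)) (h k (by omega))]

/-- Meant for lowering operators, for which commutation is not at hand: the factors before place `i`
are trivial, so `g i` stands next to its own power. -/
theorem mul_powProd_of_zero {g : ℕ → M} {m i : ℕ} {b : ℕ → ℕ} (him : i < m)
    (hb : ∀ j < i, b j = 0) : g i * powProd g m b = powProd g m (b + Pi.single i 1) := by
  induction m with
  | zero => omega
  | succ m ih =>
    rw [powProd_succ, powProd_succ]
    rcases Nat.lt_succ_iff_lt_or_eq.1 him with h | rfl
    · rw [← mul_assoc, ih h]
      simp [Pi.single_eq_of_ne (show m ≠ i by omega)]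
    · have h1 : powProd g i b = 1 := by
        rw [powProd_congr (g' := g) (b := 0) (fun _ _ => rfl) (by simpa using hb)]
        simp [powProd]
      have h2 : powProd g i (b + Pi.single i 1) = 1 := by
        rw [powProd_congr (g' := g) (b := 0) (fun _ _ => rfl)
          (fun j hj => by simp [hb j hj, Pi.single_eq_of_ne (show j ≠ i by omega)])]
        simp [powProd]
      rw [h1, h2, one_mul, one_mul, ← pow_succ']
      simp

/-- The exponents of the Gelfand–Tsetlin patterns with `k` rows and top row `mu`. -/
def Adm : ℕ → (ℕ → ℂ) → (ℕ → ℕ → ℕ) → Prop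
  | 0, _, _ => True
  | k + 1, mu, A =>
    (∀ i < k, IsNat (mu i - mu (i + 1) - A k i)) ∧ Adm k (fun i => mu i - A k i) A

theorem Adm.congr {k : ℕ} {mu : ℕ → ℂ} {A B : ℕ → ℕ → ℕ} (hA : Adm k mu A)
    (h : ∀ r < k, A r = B r) : Adm k mu B := by
  induction k generalizing mu with
  | zero => trivial
  | succ k ih =>
    refine ⟨?_, ?_⟩
    · rw [← h k (by omega)]
      exact hA.1
    · rw [← h k (by omega)]
      exact ih hA.2 fun r hr => h r (by omega)

/-- Lexicographic comparison of arrays, starting with the last row. -/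
def ArrLt (k : ℕ) (B A : ℕ → ℕ → ℕ) : Prop :=
  ∃ r < k, RowLt r (B r) (A r) ∧ ∀ s, r < s → s < k → ∀ i < s, B s i = A s i

end Arrays

/-! ### Leading terms of lowering operators -/

section Lowering

variable {V : Type*} [AddCommGroup V] [Module ℂ V]

/-- The properties of the lowering operators `z k i = p k * e k i * q k i` that determine their
leading terms: `q k i` acts by scalars on weight vectors, and `p k` is the identity modulo raised
vectors. -/
structure IsLowering (n : ℕ) (e : ℕ → ℕ → Module.End ℂ V) (p : ℕ → Module.End ℂ V)
    (q z : ℕ → ℕ → Module.End ℂ V) : Prop where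
  eq_mul : ∀ k i, i < k → k < n → z k i = p k * e k i * q k i
  q_weight : ∀ k i, i < k → k < n → ∀ (nu : ℕ → ℂ) (x : V), (∀ b < k, e b b x = nu b • x) →
    q k i x = (∏ j ∈ Finset.Ioo i k, (nu i - nu j + ((j : ℂ) - i))) • x
  q_stable : ∀ k i, i < k → k < n → ∀ N : Submodule ℂ V, (∀ b < k, ∀ x ∈ N, e b b x ∈ N) →
    ∀ x ∈ N, q k i x ∈ N
  -- The intermediate `F'` may depend on the root. Where `F` itself is not stable under the root
  -- vectors, the smaller subspace `N` will be used.
  p_congr : ∀ k < n, ∀ G F : Submodule ℂ V, F ≤ G → (∀ b < k, ∀ x ∈ G, e b b x ∈ G) →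
    (∀ b c, b < c → c < k → ∃ F' ≤ F, (∀ x ∈ G, e b c x ∈ F') ∧
      ∀ x ∈ F', e b c x ∈ F' ∧ e c b x ∈ F') → ∀ y ∈ G, p k y - y ∈ F

variable {n : ℕ} {e : ℕ → ℕ → Module.End ℂ V} {p : ℕ → Module.End ℂ V}
  {q z : ℕ → ℕ → Module.End ℂ V} {k : ℕ} {N : Submodule ℂ V} {w : V} {mu : ℕ → ℂ}

theorem IsLowering.mem_stabilizer (hz : IsLowering n e p q z) (hk : k < n)
    (hN : IsStable e 0 (k + 1) N) {i : ℕ} (hi : i < k) : z k i ∈ stabilizer N := by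
  intro x hx
  rw [hz.eq_mul k i hi hk, Module.End.mul_apply, Module.End.mul_apply]
  have h1 := hN.1 k i (Nat.zero_le _) (by omega) (Nat.zero_le _) (by omega) _
    (hz.q_stable k i hi hk N (fun b hb => hN.2 b (by omega)) x hx)
  have h2 := hz.p_congr k hk N N le_rfl (fun b hb => hN.2 b (by omega)) (fun b c hb hc =>
    ⟨N, le_rfl, hN.1 b c (Nat.zero_le _) (by omega) (Nat.zero_le _) (by omega), fun x hx =>
      ⟨hN.1 b c (Nat.zero_le _) (by omega) (Nat.zero_le _) (by omega) x hx,
        hN.1 c b (Nat.zero_le _) (by omega) (Nat.zero_le _) (by omega) x hx⟩⟩) _ h1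
  exact (N.sub_mem_iff_left h1).1 h2

theorem IsLowering.arrProd_mem_stabilizer (hz : IsLowering n e p q z) (hk : k ≤ n)
    (hN : IsStable e 0 k N) (A : ℕ → ℕ → ℕ) : arrProd z k A ∈ stabilizer N := by
  induction k with
  | zero => exact one_mem _
  | succ k ih =>
    rw [arrProd_succ]
    exact mul_mem (ih (by omega) (hN.mono le_rfl (by omega)))
      (powProd_mem_stabilizer (fun i hi => hz.mem_stabilizer (by omega) hN hi) _)

variable (he : IsGl n e) (hz : IsLowering n e p q z) (hk : k < n) (hN : IsStable e 0 (k + 1) N)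
  (hw : IsSingular e (k + 1) N mu w)

include he hz hk hN hw

/-- The operator `q k i` multiplies the leading monomial by the product of weight differences, and
`e k i` shifts both the monomial and its error. On the span `G` of the new monomial and `F`, every
raising operator lands in `F`, so `p k` changes the result only within `F`. -/
theorem IsSingular.lowering_step {a : ℕ → ℕ} {i : ℕ} (hi : i < k) (ha : ∀ j < i, a j = 0) {y : V}
    {r : ℂ} (hy : y - r • powProd (e k) k a w ∈ rowBelow e k N w i a) :
    z k i y - (r * ∏ j ∈ Finset.Ioo i k, ((mu i - a i) - (mu j - a j) + ((j : ℂ) - i))) •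
      powProd (e k) k (a + Pi.single i 1) w ∈ rowBelow e k N w i (a + Pi.single i 1) := by
  set s := ∏ j ∈ Finset.Ioo i k, ((mu i - a i) - (mu j - a j) + ((j : ℂ) - i))
  set a' := a + Pi.single i 1 with ha'
  have h1 : q k i y - (r * s) • powProd (e k) k a w ∈ rowBelow e k N w i a := by
    have := hz.q_stable k i hi hk _ rowBelow_isStable.2 _ hy
    rwa [map_sub, map_smul, hz.q_weight k i hi hk (fun b => mu b - a b) _
      (fun b hb => hw.row_weight he hk hb), smul_smul] at this
  have h2 := row_apply_rowBelow he hk hN le_rfl hi h1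
  rw [map_sub, map_smul, he.row_mul hk hi, ← ha'] at h2
  have hvan : ∀ j < i, a' j = 0 := fun j hj => by
    simp [ha', ha j hj, Pi.single_eq_of_ne (show j ≠ i by omega)]
  set F := rowBelow e k N w i a' with hF
  set x := powProd (e k) k a' w with hx
  let G : Submodule ℂ V := F ⊔ Submodule.span ℂ {x}
  have hG : ∀ {y : V} {Q : Submodule ℂ V} {f : Module.End ℂ V}, (∀ u ∈ F, f u ∈ Q) → f x ∈ Q →
      y ∈ G → f y ∈ Q := by
    intro y Q f hf hfx hy
    have : G ≤ Q.comap f := sup_le hf (by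
      rw [Submodule.span_le, Set.singleton_subset_iff]
      exact hfx)
    exact this hy
  have hxG : x ∈ G := Submodule.mem_sup_right (Submodule.mem_span_singleton_self x)
  have hFG : F ≤ G := le_sup_left
  have hy2 : e k i (q k i y) ∈ G := by
    rw [← sub_add_cancel (e k i (q k i y)) ((r * s) • x)]
    exact G.add_mem (hFG h2) (G.smul_mem _ hxG)
  have h3 := hz.p_congr k hk G F hFG ?_ ?_ _ hy2
  · rw [hz.eq_mul k i hi hk, Module.End.mul_apply, Module.End.mul_apply]
    have := F.add_mem h3 h2
    rwa [sub_add_sub_cancel] at this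
  · intro b hb u hu
    refine hG (fun u hu => hFG (rowBelow_isStable.2 b hb u hu)) ?_ hu
    rw [hx, hw.row_weight he hk hb]
    exact G.smul_mem _ hxG
  · intro b c hbc hc
    -- `F` is stable only under indices from `i` on. For `b < i` the exponent at `b` is zero, so the
    -- raising operator sends all of `G` into `N`.
    rcases lt_or_ge b i with hbi | hbi
    · refine ⟨N, le_rowBelow, fun u hu => hG (fun u hu => ?_) ?_ hu, fun u hu => ⟨?_, ?_⟩⟩
      · exact hw.rowBelow_killed he hk hN hbi hbc hc hu
      · exact hw.row_killed he hk hN hbi hbc hc hvan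
      · exact hN.1 b c (Nat.zero_le _) (by omega) (Nat.zero_le _) (by omega) u hu
      · exact hN.1 c b (Nat.zero_le _) (by omega) (Nat.zero_le _) (by omega) u hu
    · have hst := rowBelow_isStable (e := e) (k := k) (N := N) (w := w) (lo := i) (a := a')
      refine ⟨F, le_rfl, fun u hu => hG (fun u hu => ?_) ?_ hu, fun u hu => ⟨?_, ?_⟩⟩
      · exact hst.1 b c hbi (by omega) (by omega) hc u hu
      · exact hw.row_raise he hk hN hbi hbc hc hvan
      · exact hst.1 b c hbi (by omega) (by omega) hc u hu
      · exact hst.1 c b (by omega) hc hbi (by omega) u hu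

omit he hz hk hN hw in
theorem isNat_sub_of_le (hdom : ∀ l, l + 1 < k → IsNat (mu l - mu (l + 1))) {i j : ℕ}
    (hij : i ≤ j) (hj : j < k) : IsNat (mu i - mu j) := by
  induction j, hij using Nat.le_induction with
  | base => exact ⟨0, by simp⟩
  | succ j hij ih =>
    have := (ih (by omega)).add (hdom j hj)
    rwa [sub_add_sub_cancel] at this

/-- Induction on the total exponent. The leftmost factor is removed; it acts last and has the least
index with nonzero exponent, as `lowering_step` requires. -/
theorem IsSingular.lowering_row (hdom : ∀ l, l + 1 < k + 1 → IsNat (mu l - mu (l + 1)))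
    {a : ℕ → ℕ} (ha : ∀ i < k, IsNat (mu i - mu (i + 1) - a i)) {lo : ℕ}
    (hlo : ∀ i < lo, a i = 0) :
    ∃ r : ℂ, r ≠ 0 ∧
      powProd (z k) k a w - r • powProd (e k) k a w ∈ rowBelow e k N w lo a := by
  obtain ⟨m, hm⟩ : ∃ m, m = ∑ i ∈ Finset.range k, a i := ⟨_, rfl⟩
  induction m generalizing a lo with
  | zero =>
    have h0 : ∀ i < k, a i = 0 := fun i hi =>
      Finset.sum_eq_zero_iff.1 hm.symm i (Finset.mem_range.2 hi)
    have h1 : ∀ g : ℕ → Module.End ℂ V, powProd g k a = 1 := fun g => by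
      rw [powProd_congr (g' := g) (b := 0) (fun _ _ => rfl) (by simpa using h0)]
      simp [powProd]
    refine ⟨1, one_ne_zero, ?_⟩
    rw [h1, h1, one_smul, sub_self]
    exact Submodule.zero_mem _
  | succ m ih =>
    have hex : ∃ i, i < k ∧ a i ≠ 0 := by
      by_contra! hc
      rw [Finset.sum_eq_zero fun i hi => hc i (Finset.mem_range.1 hi)] at hm
      omega
    classical
    set i := Nat.find hex with hi_def
    obtain ⟨hi, hai⟩ := Nat.find_spec hex
    rw [← hi_def] at hi hai
    have hmin : ∀ j < i, a j = 0 := fun j hj => by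
      have := Nat.find_min hex hj
      by_contra h0
      exact this ⟨by omega, h0⟩
    obtain ⟨b, hb⟩ : ∃ b : ℕ → ℕ, b = a - Pi.single i 1 := ⟨_, rfl⟩
    have hab : a = b + Pi.single i 1 := by
      ext l
      by_cases hl : l = i
      · subst hl
        simp [hb]
        omega
      · simp [hb, Pi.single_eq_of_ne hl]
    clear_value i
    clear hi_def hb
    subst hab
    have hbv : ∀ j < i, b j = 0 := fun j hj => by
      simpa [Pi.single_eq_of_ne (show j ≠ i by omega)] using hmin j hj
    have hbn : ∀ j < k, IsNat (mu j - mu (j + 1) - b j) := fun j hj => by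
      by_cases hji : j = i
      · subst hji
        have := (ha j hj).add (IsNat.natCast 1)
        simpa [sub_add_eq_sub_sub] using this
      · simpa [Pi.single_eq_of_ne hji] using ha j hj
    obtain ⟨r, hr, hmem⟩ := ih hbn hbv (by
      simp only [Pi.add_apply, Finset.sum_add_distrib] at hm
      rw [Finset.sum_pi_single' i 1 (Finset.range k)] at hm
      simp only [Finset.mem_range, hi, if_true] at hm
      omega)
    have hstep := hw.lowering_step he hz hk hN hi hbv hmem
    rw [← Module.End.mul_apply, mul_powProd_of_zero hi hbv] at hstep
    refine ⟨_, mul_ne_zero hr ?_, rowBelow_mono ?_ (fun _ h => h) hstep⟩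
    · refine Finset.prod_ne_zero_iff.2 fun j hj => ?_
      obtain ⟨hij, hjk⟩ := Finset.mem_Ioo.1 hj
      obtain ⟨m1, hm1⟩ := ha i hi
      obtain ⟨m2, hm2⟩ := isNat_sub_of_le hdom (show i + 1 ≤ j by omega) (by omega)
      obtain ⟨d, rfl⟩ := Nat.exists_eq_add_of_lt hij
      -- The exponent at `i` in the interlacing bound is `b i + 1`, so with j = `i + d + 1` the
      -- factor is the sum of `m1 + 1`, `m2`, the exponent at j and j - i: a positive integer.
      have h3 : (mu i - b i) - (mu (i + d + 1) - b (i + d + 1)) + (((i + d + 1 : ℕ) : ℂ) - i) =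
          ((m1 + 1 + m2 + b (i + d + 1) + d + 1 : ℕ) : ℂ) := by
        simp only [Pi.add_apply, Pi.single_eq_same] at hm1
        push_cast at hm1 ⊢
        linear_combination hm1 + hm2
      rw [h3]
      exact Nat.cast_ne_zero.2 (Nat.succ_ne_zero _)
    · by_contra! hc
      exact hai (hlo i hc)

end Lowering

/-! ### Descent along the chain of subalgebras -/

section Branching

variable {V : Type*} [AddCommGroup V] [Module ℂ V]
  {n : ℕ} {e : ℕ → ℕ → Module.End ℂ V} {p : ℕ → Module.End ℂ V}
  {q z : ℕ → ℕ → Module.End ℂ V} {k : ℕ} {N : Submodule ℂ V} {w : V} {mu : ℕ → ℂ}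

/-- The span of the monomial vectors whose exponents are admissible for `mu` and satisfy `P`. -/
def monoSpan (e : ℕ → ℕ → Module.End ℂ V) (k : ℕ) (mu : ℕ → ℂ) (w : V)
    (P : (ℕ → ℕ → ℕ) → Prop) : Submodule ℂ V :=
  Submodule.span ℂ {x | ∃ A, Adm k mu A ∧ P A ∧ x = arrProd e k A w}

theorem monoSpan_mono {P P' : (ℕ → ℕ → ℕ) → Prop} (h : ∀ A, P A → P' A) :
    monoSpan e k mu w P ≤ monoSpan e k mu w P' :=
  Submodule.span_mono fun _ ⟨A, h1, h2, h3⟩ => ⟨A, h1, h A h2, h3⟩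

theorem monoSpan_row_le {b : ℕ → ℕ} (hb : ∀ i < k, IsNat (mu i - mu (i + 1) - b i))
    {P P' : (ℕ → ℕ → ℕ) → Prop} (h : ∀ A, P A → P' (Function.update A k b)) :
    monoSpan e k (fun i => mu i - b i) (powProd (e k) k b w) P ≤ monoSpan e (k + 1) mu w P' := by
  refine Submodule.span_le.2 ?_
  rintro x ⟨A, h1, h2, rfl⟩
  refine Submodule.subset_span ⟨Function.update A k b, ⟨?_, ?_⟩, h A h2, ?_⟩
  · simpa using hb
  · simp only [Function.update_self]
    exact h1.congr fun r hr => by rw [Function.update_of_ne (by omega)]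
  · have : arrProd e k (Function.update A k b) = arrProd e k A :=
      arrProd_congr (fun _ _ _ _ => rfl) fun r hr i _ => by rw [Function.update_of_ne (by omega)]
    rw [arrProd_succ, Function.update_self, Module.End.mul_apply, this]

/-- Sums of stable subspaces are stable, so the generators can be treated one at a time. -/
theorem span_levelHull_le {S : Set V} (hN : IsStable e 0 k N) :
    levelHull e 0 k (N ∪ S) ≤ N ⊔ ⨆ x : S, levelHull e 0 k {(x : V)} := by
  refine levelHull_le ?_ (hN.sup (IsStable.iSup fun x => levelHull_isStable))
  rintro x (hx | hx)
  · exact Submodule.mem_sup_left hx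
  · exact Submodule.mem_sup_right
      (Submodule.mem_iSup_of_mem (⟨x, hx⟩ : S) (subset_levelHull rfl))

theorem IsSingular.row (he : IsGl n e) (hk : k < n) (hN : IsStable e 0 (k + 1) N)
    (hw : IsSingular e (k + 1) N mu w) (b : ℕ → ℕ) :
    IsSingular e k (rowBelow e k N w 0 b) (fun i => mu i - b i) (powProd (e k) k b w) :=
  ⟨fun _ _ h1 h2 => hw.row_raise he hk hN (Nat.zero_le _) h1 h2
    fun _ h => absurd h (Nat.not_lt_zero _), fun _ h => hw.row_weight he hk h⟩

theorem isNat_row_sub {b : ℕ → ℕ} (hb : ∀ i < k, IsNat (mu i - mu (i + 1) - b i)) (l : ℕ)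
    (hl : l + 1 < k) : IsNat (mu l - b l - (mu (l + 1) - b (l + 1))) := by
  have := (hb l (by omega)).add (IsNat.natCast (b (l + 1)))
  convert this using 1
  ring

/-- Either the exponent interlaces with `mu`, and the induction hypothesis for 𝔤𝔩_k applies modulo
`rowBelow`, or it is too large at some place and the monomial already lies in `rowBelow`. -/
theorem levelHull_row_le_monoSpan [FiniteDimensional ℂ V] (he : IsGl n e) (hk : k < n)
    (hN : IsStable e 0 (k + 1) N) (hw : IsSingular e (k + 1) N mu w)
    (hdom : ∀ l, l + 1 < k + 1 → IsNat (mu l - mu (l + 1)))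
    (ih : ∀ (N : Submodule ℂ V) (w : V) (mu : ℕ → ℂ), IsStable e 0 k N → IsSingular e k N mu w →
      (∀ l, l + 1 < k → IsNat (mu l - mu (l + 1))) →
      levelHull e 0 k {w} ≤ N ⊔ monoSpan e k mu w fun _ => True) (b : ℕ → ℕ) :
    levelHull e 0 k {powProd (e k) k b w} ≤
      rowBelow e k N w 0 b ⊔ monoSpan e (k + 1) mu w fun A => A k = b := by
  by_cases hb : ∀ i < k, IsNat (mu i - mu (i + 1) - b i)
  · refine (ih _ _ _ rowBelow_isStable (hw.row he hk hN b) (isNat_row_sub hb)).trans ?_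
    exact sup_le_sup_left (monoSpan_row_le hb fun A _ => Function.update_self _ _ _) _
  · push Not at hb
    obtain ⟨i, hi, hb⟩ := hb
    obtain ⟨m, hm⟩ := hdom i (by omega)
    refine le_sup_of_le_left (levelHull_le (Set.singleton_subset_iff.2 ?_) rowBelow_isStable)
    refine hw.row_mem_rowBelow_self he hk hN hi hm ?_
    by_contra! hc
    exact hb ⟨m - b i, by rw [hm, Nat.cast_sub hc]⟩

theorem rowBelow_le_monoSpan [FiniteDimensional ℂ V] (he : IsGl n e) (hk : k < n)
    (hN : IsStable e 0 (k + 1) N) (hw : IsSingular e (k + 1) N mu w)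
    (hdom : ∀ l, l + 1 < k + 1 → IsNat (mu l - mu (l + 1)))
    (ih : ∀ (N : Submodule ℂ V) (w : V) (mu : ℕ → ℂ), IsStable e 0 k N → IsSingular e k N mu w →
      (∀ l, l + 1 < k → IsNat (mu l - mu (l + 1))) →
      levelHull e 0 k {w} ≤ N ⊔ monoSpan e k mu w fun _ => True) (b : ℕ → ℕ) :
    rowBelow e k N w 0 b ≤ N ⊔ monoSpan e (k + 1) mu w fun A => RowLt k (A k) b := by
  induction b using (wellFounded_rowLt k).induction with
  | _ b IH =>
    refine (span_levelHull_le (hN.mono le_rfl (by omega))).trans (sup_le le_sup_left ?_)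
    refine iSup_le ?_
    rintro ⟨x, c, hc, -, rfl⟩
    refine (levelHull_row_le_monoSpan he hk hN hw hdom ih c).trans (sup_le ?_ ?_)
    · exact (IH c hc).trans (sup_le_sup_left (monoSpan_mono fun A hA => hA.trans hc) _)
    · exact le_sup_of_le_right (monoSpan_mono fun A hA => by rwa [hA])

/-- A form of the PBW theorem modulo `N`. Row operators permute the row monomials among themselves
and commute with 𝔤𝔩_k up to row operators, which gives `hrow`. Moving `e j k` past `e k i` creates
`e j i`, a row operator when `j = k`; so `hcol` relies on `hrow` and on induction over the exponent.
-/
theorem levelHull_succ_le (he : IsGl n e) (hk : k < n) (hN : IsStable e 0 (k + 1) N)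
    (hw : IsSingular e (k + 1) N mu w) :
    levelHull e 0 (k + 1) {w} ≤
      levelHull e 0 k (N ∪ {x | ∃ b, x = powProd (e k) k b w}) := by
  set G := levelHull e 0 k (N ∪ {x | ∃ b, x = powProd (e k) k b w}) with hG
  have hst : IsStable e 0 k G := levelHull_isStable
  have hNG : N ≤ G := fun x hx => subset_levelHull (Or.inl hx)
  have hrow : ∀ j < k, ∀ x ∈ G, e k j x ∈ G := by
    let Q : Submodule ℂ V :=
      { carrier := {y | y ∈ G ∧ ∀ j < k, e k j y ∈ G}
        add_mem' := fun hx hy => ⟨G.add_mem hx.1 hy.1, fun j hj => by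
          rw [map_add]; exact G.add_mem (hx.2 j hj) (hy.2 j hj)⟩
        zero_mem' := ⟨G.zero_mem, fun j _ => by rw [map_zero]; exact G.zero_mem⟩
        smul_mem' := fun r x hx => ⟨G.smul_mem r hx.1, fun j hj => by
          rw [map_smul]; exact G.smul_mem r (hx.2 j hj)⟩ }
    have hstep : ∀ a b, a < k → b < k → ∀ x ∈ Q, e a b x ∈ Q := fun a b ha hb x hx => by
      have h0 : ∀ y ∈ G, e a b y ∈ G := hst.1 a b (Nat.zero_le _) ha (Nat.zero_le _) hb
      refine ⟨h0 x hx.1, fun j hj => ?_⟩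
      rw [he.apply (by omega) (by omega) (by omega) (by omega), if_neg (show ¬ b = k by omega),
        sub_zero]
      refine G.add_mem (h0 _ (hx.2 j hj)) ?_
      split_ifs
      · exact hx.2 b hb
      · exact G.zero_mem
    have hQ : G ≤ Q := by
      refine levelHull_le ?_ ⟨fun a b _ ha _ hb => hstep a b ha hb, fun a ha => hstep a a ha ha⟩
      rintro x (hx | ⟨b, rfl⟩)
      · exact ⟨hNG hx, fun j hj =>
          hNG (hN.1 k j (Nat.zero_le _) (by omega) (Nat.zero_le _) (by omega) x hx)⟩
      · exact ⟨subset_levelHull (Or.inr ⟨b, rfl⟩), fun j hj =>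
          subset_levelHull (Or.inr ⟨_, he.row_mul hk hj b w⟩)⟩
    exact fun j hj x hx => (hQ hx).2 j hj
  have hcol : ∀ j < k + 1, ∀ x ∈ G, e j k x ∈ G := by
    let Q : Submodule ℂ V :=
      { carrier := {y | y ∈ G ∧ ∀ j < k + 1, e j k y ∈ G}
        add_mem' := fun hx hy => ⟨G.add_mem hx.1 hy.1, fun j hj => by
          rw [map_add]; exact G.add_mem (hx.2 j hj) (hy.2 j hj)⟩
        zero_mem' := ⟨G.zero_mem, fun j _ => by rw [map_zero]; exact G.zero_mem⟩
        smul_mem' := fun r x hx => ⟨G.smul_mem r hx.1, fun j hj => by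
          rw [map_smul]; exact G.smul_mem r (hx.2 j hj)⟩ }
    have hstep : ∀ a b, a < k → b < k → ∀ x ∈ Q, e a b x ∈ Q := fun a b ha hb x hx => by
      have h0 : ∀ y ∈ G, e a b y ∈ G := hst.1 a b (Nat.zero_le _) ha (Nat.zero_le _) hb
      refine ⟨h0 x hx.1, fun j hj => ?_⟩
      rw [he.apply (by omega) (by omega) (by omega) (by omega), if_neg (show ¬ k = a by omega),
        add_zero]
      refine G.sub_mem (h0 _ (hx.2 j hj)) ?_
      split_ifs
      · exact hx.2 a (by omega)
      · exact G.zero_mem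
    have hQ : G ≤ Q := by
      refine levelHull_le ?_ ⟨fun a b _ ha _ hb => hstep a b ha hb, fun a ha => hstep a a ha ha⟩
      rintro x (hx | ⟨b, rfl⟩)
      · exact ⟨hNG hx, fun j hj =>
          hNG (hN.1 j k (Nat.zero_le _) (by omega) (Nat.zero_le _) (by omega) x hx)⟩
      · refine ⟨subset_levelHull (Or.inr ⟨b, rfl⟩), ?_⟩
        induction b using row_induction k with
        | h0 b hb =>
          intro j hj
          have h1 : powProd (e k) k b = 1 := by
            rw [powProd_congr (g' := e k) (b := 0) (fun _ _ => rfl) (by simpa using hb)]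
            simp [powProd]
          have hwG : w ∈ G := subset_levelHull (Or.inr ⟨b, by rw [h1, Module.End.one_apply]⟩)
          rw [h1, Module.End.one_apply]
          rcases Nat.lt_succ_iff_lt_or_eq.1 hj with h | rfl
          · exact hNG (hw.raise j k h (by omega))
          · rw [hw.weight j hj]
            exact G.smul_mem _ hwG
        | hs b i hi IH =>
          intro j hj
          have hbG : powProd (e k) k b w ∈ G := subset_levelHull (Or.inr ⟨b, rfl⟩)
          rw [← he.row_mul hk hi, he.apply (by omega) (by omega) (by omega) (by omega), if_pos rfl]
          have h3 : e j i (powProd (e k) k b w) ∈ G := by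
            rcases Nat.lt_succ_iff_lt_or_eq.1 hj with h | rfl
            · exact hst.1 j i (Nat.zero_le _) h (Nat.zero_le _) hi _ hbG
            · exact hrow i hi _ hbG
          refine G.sub_mem (G.add_mem (hrow i hi _ (IH j hj)) h3) ?_
          split_ifs
          · exact IH k (by omega)
          · exact G.zero_mem
    exact fun j hj x hx => (hQ hx).2 j hj
  refine levelHull_le ?_ ⟨fun a b _ ha _ hb x hx => ?_, fun a ha x hx => ?_⟩
  · rw [Set.singleton_subset_iff]
    exact subset_levelHull (Or.inr ⟨0, by simp [powProd]⟩)
  · rcases Nat.lt_succ_iff_lt_or_eq.1 hb with hb' | rfl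
    · rcases Nat.lt_succ_iff_lt_or_eq.1 ha with ha' | rfl
      · exact hst.1 a b (Nat.zero_le _) ha' (Nat.zero_le _) hb' x hx
      · exact hrow b hb' x hx
    · exact hcol a ha x hx
  · rcases Nat.lt_succ_iff_lt_or_eq.1 ha with ha' | rfl
    · exact hst.2 a ha' x hx
    · exact hcol a ha x hx

theorem levelHull_le_monoSpan [FiniteDimensional ℂ V] (he : IsGl n e) (hk : k ≤ n)
    (hN : IsStable e 0 k N) (hw : IsSingular e k N mu w)
    (hdom : ∀ l, l + 1 < k → IsNat (mu l - mu (l + 1))) :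
    levelHull e 0 k {w} ≤ N ⊔ monoSpan e k mu w fun _ => True := by
  induction k generalizing N w mu with
  | zero =>
    refine le_sup_of_le_right (levelHull_le ?_
      ⟨fun a b _ h => absurd h (Nat.not_lt_zero _), fun a h => absurd h (Nat.not_lt_zero _)⟩)
    rw [Set.singleton_subset_iff]
    exact Submodule.subset_span ⟨0, trivial, trivial, rfl⟩
  | succ k ih =>
    have ih' : ∀ (N : Submodule ℂ V) (w : V) (mu : ℕ → ℂ), IsStable e 0 k N →
        IsSingular e k N mu w → (∀ l, l + 1 < k → IsNat (mu l - mu (l + 1))) →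
        levelHull e 0 k {w} ≤ N ⊔ monoSpan e k mu w fun _ => True :=
      fun N w mu h1 h2 h3 => ih (by omega) h1 h2 h3
    refine (levelHull_succ_le he hk hN hw).trans
      ((span_levelHull_le (hN.mono le_rfl (by omega))).trans (sup_le le_sup_left (iSup_le ?_)))
    rintro ⟨x, c, rfl⟩
    refine (levelHull_row_le_monoSpan he hk hN hw hdom ih' c).trans (sup_le ?_ ?_)
    · exact (rowBelow_le_monoSpan he hk hN hw hdom ih' c).trans
        (sup_le_sup_left (monoSpan_mono fun _ _ => trivial) _)
    · exact le_sup_of_le_right (monoSpan_mono fun _ _ => trivial)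

/-- The last row acts first, and `lowering_row` replaces it by its monomial modulo `rowBelow`. The
shorter rows preserve this subspace, which then plays the role of `N` in the induction hypothesis.
-/
theorem lowering_triangular [FiniteDimensional ℂ V] (he : IsGl n e) (hz : IsLowering n e p q z)
    (hk : k ≤ n) (hN : IsStable e 0 k N) (hw : IsSingular e k N mu w)
    (hdom : ∀ l, l + 1 < k → IsNat (mu l - mu (l + 1))) {A : ℕ → ℕ → ℕ} (hA : Adm k mu A) :
    ∃ r : ℂ, r ≠ 0 ∧ arrProd z k A w - r • arrProd e k A w ∈
      N ⊔ monoSpan e k mu w fun B => ArrLt k B A := by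
  induction k generalizing N w mu with
  | zero => exact ⟨1, one_ne_zero, by simp⟩
  | succ k ih =>
    obtain ⟨r, hr, h1⟩ := hw.lowering_row he hz hk hN hdom hA.1
      (lo := 0) (fun _ h => absurd h (Nat.not_lt_zero _))
    obtain ⟨s, hs, h2⟩ := ih (by omega) rowBelow_isStable (hw.row he hk hN (A k))
      (isNat_row_sub hA.1) hA.2
    refine ⟨r * s, mul_ne_zero hr hs, ?_⟩
    set R := N ⊔ monoSpan e (k + 1) mu w fun B => ArrLt (k + 1) B A
    have hF : rowBelow e k N w 0 (A k) ≤ R := by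
      refine (rowBelow_le_monoSpan he hk hN hw hdom (fun N w mu h1 h2 h3 =>
        levelHull_le_monoSpan he (by omega) h1 h2 h3) (A k)).trans
        (sup_le_sup_left (monoSpan_mono fun B hB => ?_) _)
      exact ⟨k, by omega, hB, fun s h1 h2 => by omega⟩
    have hM : monoSpan e k (fun i => mu i - A k i) (powProd (e k) k (A k) w)
        (fun B => ArrLt k B A) ≤ R := by
      refine le_sup_of_le_right (monoSpan_row_le hA.1 ?_)
      rintro B ⟨l, hl, hlt, heq⟩
      refine ⟨l, by omega, by rwa [Function.update_of_ne (by omega)], fun m hm hm' i hi => ?_⟩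
      by_cases hmk : m = k
      · rw [hmk, Function.update_self]
      · rw [Function.update_of_ne hmk]
        exact heq m hm (by omega) i hi
    have h3 := hz.arrProd_mem_stabilizer (k := k) (by omega) rowBelow_isStable A _ h1
    rw [map_sub, map_smul] at h3
    have h4 := R.add_mem (hF h3) (R.smul_mem r ((sup_le hF hM) h2))
    rw [arrProd_succ, arrProd_succ, Module.End.mul_apply, Module.End.mul_apply]
    convert h4 using 1
    rw [smul_sub, smul_smul]
    abel

end Branching

/-! ### Passage from indices in `Fin n` to natural numbers -/

section OfFin

/-- The extension by zero of an array indexed by `Fin n`. -/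
def ofFin {n : ℕ} {M : Type*} [Zero M] (f : Fin n → Fin n → M) (i j : ℕ) : M :=
  if h : i < n ∧ j < n then f ⟨i, h.1⟩ ⟨j, h.2⟩ else 0

theorem ofFin_apply {n : ℕ} {M : Type*} [Zero M] (f : Fin n → Fin n → M) {i j : ℕ} (hi : i < n)
    (hj : j < n) : ofFin f i j = f ⟨i, hi⟩ ⟨j, hj⟩ := dif_pos ⟨hi, hj⟩

@[simp] theorem ofFin_val {n : ℕ} {M : Type*} [Zero M] (f : Fin n → Fin n → M) (i j : Fin n) :
    ofFin f (i : ℕ) (j : ℕ) = f i j := ofFin_apply f i.2 j.2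

theorem filter_range_lt {k n : ℕ} (hk : k ≤ n) :
    (List.range n).filter (fun i => decide (i < k)) = List.range k := by
  induction n, hk using Nat.le_induction with
  | base => exact List.filter_eq_self.2 fun a ha => by simpa using List.mem_range.1 ha
  | succ n hn ih => rw [List.range_succ, List.filter_append, ih]; simp [hn]

theorem finRange_filter_map_val {n : ℕ} (k : Fin n) :
    ((List.finRange n).filter fun i : Fin n => i < k).map (fun i : Fin n => (i : ℕ)) =
      List.range k := by
  have h1 : (fun i : Fin n => decide (i < k)) =
      (fun i : ℕ => decide (i < (k : ℕ))) ∘ fun i : Fin n => (i : ℕ) := by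
    ext i; simp
  rw [h1, ← List.filter_map, List.map_coe_finRange_eq_range, filter_range_lt k.2.le]

theorem orderedProd_pow {n : ℕ} {M : Type*} [MonoidWithZero M] (f : Fin n → Fin n → M)
    (A : Fin n → Fin n → ℕ) :
    orderedProd (fun k i => f k i ^ A k i) = arrProd (ofFin f) n (ofFin A) := by
  rw [orderedProd, arrProd, ← List.map_coe_finRange_eq_range, List.map_map]
  congr 1
  refine List.map_congr_left fun k _ => ?_
  rw [Function.comp_apply, powProd, ← finRange_filter_map_val, List.map_map]
  congr 1
  refine List.map_congr_left fun i _ => ?_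
  simp

theorem isGl_ofFin {n : ℕ} {V : Type*} [AddCommGroup V] [Module ℂ V]
    {f : Fin n → Fin n → Module.End ℂ V}
    (hf : ∀ a b c d, f a b * f c d =
      f c d * f a b + (if b = c then f a d else 0) - (if d = a then f c b else 0)) :
    IsGl n (ofFin f) := by
  intro a b c d ha hb hc hd
  rw [ofFin_apply f ha hb, ofFin_apply f hc hd, ofFin_apply f ha hd, ofFin_apply f hc hb, hf]
  simp only [Fin.mk.injEq]

end OfFin

/-! ### Matrix units and extremal projectors on the module -/

section Operators

variable {n : ℕ} (V : Type*) [AddCommGroup V] [Module ℂ V] [LieRingModule (gl n) V]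
  [LieModule ℂ (gl n) V]

theorem E_mul_E (a b c d : Fin n) : E V a b * E V c d =
    E V c d * E V a b + (if b = c then E V a d else 0) - (if d = a then E V c b else 0) := by
  have h1 : E V a b * E V c d - E V c d * E V a b =
      LieModule.toEnd ℂ (gl n) V ⁅Matrix.single a b (1 : ℂ), Matrix.single c d (1 : ℂ)⁆ := by
    rw [LieHom.map_lie]
    rfl
  have h2 : ⁅Matrix.single a b (1 : ℂ), Matrix.single c d (1 : ℂ)⁆ =
      (if b = c then Matrix.single a d (1 : ℂ) else 0) -
        (if d = a then Matrix.single c b (1 : ℂ) else 0) := by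
    rw [LieRing.of_associative_ring_bracket]
    congr 1
    · split_ifs with h
      · subst h; simp
      · exact Matrix.single_mul_single_of_ne _ _ _ _ h _
    · split_ifs with h
      · subst h; simp
      · exact Matrix.single_mul_single_of_ne _ _ _ _ h _
  rw [h2, map_sub] at h1
  rw [add_sub_assoc, ← sub_eq_iff_eq_add', h1]
  congr 1 <;> split_ifs <;> simp [E]

theorem isGl_E : IsGl n (ofFin (E (n := n) V)) := isGl_ofFin (E_mul_E V)

variable {V}

/-- The diagonal function is a polynomial in `E V i i - E V j j` and preserves `G`. In a term with
`r ≥ 1` the first raising then leads into `F'`, where the rest stays. The values of the coefficients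
play no role. -/
theorem rootProj_congr {G F F' : Submodule ℂ V} {i j : Fin n} (hF' : F' ≤ F)
    (hi : ∀ x ∈ G, E V i i x ∈ G) (hj : ∀ x ∈ G, E V j j x ∈ G) (hG : ∀ x ∈ G, E V i j x ∈ F')
    (hup : ∀ x ∈ F', E V i j x ∈ F') (hdown : ∀ x ∈ F', E V j i x ∈ F') {y : V} (hy : y ∈ G) :
    rootProj V i j y - y ∈ F := by
  rw [rootProj, LinearMap.add_apply, Module.End.one_apply, add_sub_cancel_left,
    LinearMap.sum_apply]
  refine Submodule.sum_mem _ fun r hr => hF' ?_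
  obtain ⟨r, rfl⟩ : ∃ s, r = s + 1 := ⟨r - 1, by have := (Finset.mem_Icc.1 hr).1; omega⟩
  rw [Module.End.mul_apply, Module.End.mul_apply]
  have hd : E V j i ∈ stabilizer F' := hdown
  have hu : E V i j ∈ stabilizer F' := hup
  have ht : E V i i - E V j j ∈ stabilizer G := sub_mem (mem_stabilizer.2 hi) (mem_stabilizer.2 hj)
  refine pow_mem hd (r + 1) _ ?_
  rw [pow_succ, Module.End.mul_apply]
  exact pow_mem hu r _ (hG _ (aeval_mem_stabilizer ht _ y hy))

/-- The operators that act on `G` as the identity modulo `F`. -/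
def congrOne (G F : Submodule ℂ V) (hFG : F ≤ G) : Submonoid (Module.End ℂ V) where
  carrier := {f | ∀ y ∈ G, f y - y ∈ F}
  one_mem' := fun y _ => by simp
  mul_mem' := fun {f g} hf hg y hy => by
    have h1 : g y ∈ G := by
      rw [← sub_add_cancel (g y) y]
      exact G.add_mem (hFG (hg y hy)) hy
    have := F.add_mem (hf _ h1) (hg y hy)
    rwa [sub_add_sub_cancel] at this

/-- Operators equal to the identity on `G` modulo `F` form a submonoid, so the order of the root
factors is immaterial. -/
theorem extremalProj_congr {m : ℕ} {G F : Submodule ℂ V} (hFG : F ≤ G)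
    (hG : ∀ i : Fin n, (i : ℕ) < m → ∀ x ∈ G, E V i i x ∈ G)
    (hE : ∀ i j : Fin n, i < j → (j : ℕ) < m → ∃ F' ≤ F, (∀ x ∈ G, E V i j x ∈ F') ∧
      ∀ x ∈ F', E V i j x ∈ F' ∧ E V j i x ∈ F') {y : V} (hy : y ∈ G) :
    extremalProj (n := n) V m y - y ∈ F := by
  have key : extremalProj (n := n) V m ∈ congrOne G F hFG := by
    refine Submonoid.list_prod_mem _ fun f hf => ?_
    obtain ⟨i, -, rfl⟩ := List.mem_map.1 hf
    refine Submonoid.list_prod_mem _ fun f hf => ?_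
    obtain ⟨j, hj, rfl⟩ := List.mem_map.1 hf
    have hj' := (List.mem_filter.1 hj).2
    simp only [decide_eq_true_eq] at hj'
    obtain ⟨F', h1, h2, h3⟩ := hE i j hj'.1 hj'.2
    have hi' : (i : ℕ) < m := lt_trans hj'.1 hj'.2
    exact fun y hy => rootProj_congr h1 (hG i hi') (hG j hj'.2) h2 (fun x hx => (h3 x hx).1)
      (fun x hx => (h3 x hx).2) hy
  exact key y hy

theorem isLowering_lowering : IsLowering n (ofFin (E (n := n) V)) (extremalProj (n := n) V)
    (ofFin fun k i => (((List.finRange n).filter fun j : Fin n => i < j ∧ j < k).map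
      fun j => h V i - h V j).prod) (ofFin (lowering (n := n) V)) where
  eq_mul k i hi hk := by
    rw [ofFin_apply _ hk (by omega), ofFin_apply _ hk (by omega), ofFin_apply _ hk (by omega)]
    rfl
  q_weight k i hi hk nu x hx := by
    have hn : i < n := by omega
    rw [ofFin_apply _ hk hn]
    have key : ∀ L : List (Fin n), (∀ j ∈ L, (j : ℕ) < k) →
        (L.map fun j => h V ⟨i, hn⟩ - h V j).prod x =
          ((L.map fun j : Fin n => (j : ℕ)).map
            fun j => nu i - nu j + ((j : ℂ) - i)).prod • x := by
      intro L hL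
      induction L with
      | nil => simp
      | cons j L ih =>
        have h1 : ∀ b : Fin n, (b : ℕ) < k → h V b x = (nu b - (b : ℕ)) • x := fun b hb => by
          have := hx b hb
          rw [ofFin_val] at this
          simp [h, this, sub_smul]
        rw [List.map_cons, List.prod_cons, Module.End.mul_apply,
          ih fun l hl => hL l (List.mem_cons_of_mem _ hl), map_smul, LinearMap.sub_apply,
          h1 ⟨i, hn⟩ hi, h1 j (hL j List.mem_cons_self), List.map_cons, List.map_cons,
          List.prod_cons]
        module
    rw [key _ fun j hj => by
      have := (List.mem_filter.1 hj).2
      simp only [decide_eq_true_eq] at this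
      exact this.2]
    rw [← List.prod_toFinset _ (((List.nodup_finRange n).filter _).map Fin.val_injective)]
    congr 2
    ext j
    simp only [List.mem_toFinset, List.mem_map, List.mem_filter, List.mem_finRange, true_and,
      decide_eq_true_eq, Finset.mem_Ioo]
    constructor
    · rintro ⟨j, hj, rfl⟩
      exact hj
    · rintro ⟨h1, h2⟩
      exact ⟨⟨j, by omega⟩, ⟨h1, h2⟩, rfl⟩
  q_stable k i hi hk N hN := by
    have hn : i < n := by omega
    rw [ofFin_apply _ hk hn]
    have h1 : ∀ b : Fin n, (b : ℕ) < k → h V b ∈ stabilizer N := fun b hb => by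
      refine sub_mem (mem_stabilizer.2 fun x hx => ?_) ((stabilizer N).smul_mem (one_mem _) _)
      have := hN b hb x hx
      rwa [ofFin_val] at this
    have h2 : (((List.finRange n).filter fun j : Fin n => ⟨i, hn⟩ < j ∧ j < ⟨k, hk⟩).map
        fun j => h V ⟨i, hn⟩ - h V j).prod ∈ stabilizer N := by
      refine Subalgebra.list_prod_mem _ fun f hf => ?_
      obtain ⟨j, hj, rfl⟩ := List.mem_map.1 hf
      have := (List.mem_filter.1 hj).2
      simp only [decide_eq_true_eq] at this
      exact sub_mem (h1 _ hi) (h1 j this.2)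
    exact h2
  p_congr k hk G F hFG hG hE y hy := by
    refine extremalProj_congr hFG (fun i hi x hx => ?_) (fun i j hij hj => ?_) hy
    · have := hG i hi x hx
      rwa [ofFin_val] at this
    · obtain ⟨F', h1, h2, h3⟩ := hE i j hij hj
      simp only [ofFin_val] at h2 h3
      exact ⟨F', h1, h2, h3⟩

theorem IsHighestWeightVector.isSingular {lam : Fin n → ℂ} {mu : ℕ → ℂ} {v : V}
    (hv : IsHighestWeightVector lam v) (hmu : ∀ i : Fin n, mu i = lam i) :
    IsSingular (ofFin (E (n := n) V)) n ⊥ mu v where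
  raise b c hbc hc := by
    rw [ofFin_apply _ (by omega) hc, Submodule.mem_bot]
    exact hv.raise _ _ hbc
  weight b hb := by
    rw [ofFin_apply _ hb hb, hv.weight, ← hmu]

theorem isStable_bot {e : ℕ → ℕ → Module.End ℂ V} {lo hi : ℕ} : IsStable e lo hi ⊥ := by
  constructor
  · rintro a b - - - - x hx
    rw [Submodule.mem_bot] at hx ⊢
    rw [hx, map_zero]
  · rintro a - x hx
    rw [Submodule.mem_bot] at hx ⊢
    rw [hx, map_zero]

theorem eq_top_of_isStable [LieModule.IsIrreducible ℂ (gl n) V] {N : Submodule ℂ V}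
    (hN : IsStable (ofFin (E (n := n) V)) 0 n N) {v : V} (hv : v ∈ N) (hv0 : v ≠ 0) : N = ⊤ := by
  let N' : LieSubmodule ℂ (gl n) V :=
    { N with
      lie_mem := by
        intro x m hm
        have hx : LieModule.toEnd ℂ (gl n) V x ∈ stabilizer N := by
          rw [Matrix.matrix_eq_sum_single x, map_sum]
          refine Subalgebra.sum_mem _ fun i _ => ?_
          rw [map_sum]
          refine Subalgebra.sum_mem _ fun j _ => ?_
          have h1 : Matrix.single i j (x i j) = x i j • Matrix.single i j (1 : ℂ) := by simp
          rw [h1, map_smul]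
          refine (stabilizer N).smul_mem ?_ _
          intro y hy
          have := hN.1 i j (Nat.zero_le _) i.2 (Nat.zero_le _) j.2 y hy
          rwa [ofFin_val] at this
        exact hx m hm }
  have h1 : N' ≠ ⊥ := by
    intro h
    have : v ∈ N' := hv
    rw [h] at this
    exact hv0 this
  have h2 : N' = ⊤ := (eq_bot_or_eq_top N').resolve_left h1
  have h3 : N'.toSubmodule = ⊤ := by rw [h2]; rfl
  exact h3

end Operators

/-! ### Tensor powers of the vector representation -/

section Words

variable {n : ℕ} (S : Type*) [Fintype S] [DecidableEq S]

/-- The matrix unit `E_{ij}` acting on functions on words, that is on the tensor power of the vector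
representation with factors indexed by `S`. -/
def wordE (i j : Fin n) : Module.End ℂ ((S → Fin n) → ℂ) where
  toFun f w := ∑ s, if w s = i then f (Function.update w s j) else 0
  map_add' f g := by
    ext w
    simp only [Pi.add_apply, ← Finset.sum_add_distrib]
    exact Finset.sum_congr rfl fun s _ => by split_ifs <;> simp
  map_smul' c f := by
    ext w
    simp only [Pi.smul_apply, smul_eq_mul, RingHom.id_apply, Finset.mul_sum]
    exact Finset.sum_congr rfl fun s _ => by split_ifs <;> simp

variable {S}

theorem wordE_apply (i j : Fin n) (f : (S → Fin n) → ℂ) (w : S → Fin n) :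
    wordE S i j f w = ∑ s, if w s = i then f (Function.update w s j) else 0 := rfl

/-- Splitting by whether the two units act at the same position: the double sum over distinct
positions is symmetric in the two units, so only the first summand survives in their commutator
(`wordE_mul`). -/
theorem wordE_wordE_apply (i j k l : Fin n) (f : (S → Fin n) → ℂ) (w : S → Fin n) :
    wordE S i j (wordE S k l f) w = (if j = k then wordE S i l f w else 0) +
      ∑ s, ∑ t, if s ≠ t ∧ w s = i ∧ w t = k then
        f (Function.update (Function.update w s j) t l) else 0 := by
  have h1 : (if j = k then wordE S i l f w else 0) =
      ∑ s, if j = k ∧ w s = i then f (Function.update w s l) else 0 := by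
    split_ifs with h
    · simp [h, wordE_apply]
    · simp [h]
  rw [h1, wordE_apply, ← Finset.sum_add_distrib]
  refine Finset.sum_congr rfl fun s _ => ?_
  rw [wordE_apply]
  by_cases hs : w s = i
  · simp only [hs, if_true, and_true, true_and]
    rw [← Finset.add_sum_erase _ _ (Finset.mem_univ s),
      ← Finset.add_sum_erase (a := s) (f := fun t => if s ≠ t ∧ w t = k then
        f (Function.update (Function.update w s j) t l) else 0) _ (Finset.mem_univ s)]
    simp only [Function.update_self, Function.update_idem, ne_eq, not_true_eq_false, false_and,
      if_false, zero_add]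
    congr 1
    refine Finset.sum_congr rfl fun t ht => ?_
    have hts : t ≠ s := Finset.ne_of_mem_erase ht
    simp [Function.update_of_ne hts, hts.symm]
  · simp [hs]

theorem wordE_mul (i j k l : Fin n) : wordE S i j * wordE S k l = wordE S k l * wordE S i j +
    (if j = k then wordE S i l else 0) - (if l = i then wordE S k j else 0) := by
  refine LinearMap.ext fun f => funext fun w => ?_
  have h1 := wordE_wordE_apply i j k l f w
  have h2 := wordE_wordE_apply k l i j f w
  have h3 : (∑ s, ∑ t, if s ≠ t ∧ w s = i ∧ w t = k then
        f (Function.update (Function.update w s j) t l) else 0) =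
      ∑ s, ∑ t, if s ≠ t ∧ w s = k ∧ w t = i then
        f (Function.update (Function.update w s l) t j) else 0 := by
    rw [Finset.sum_comm]
    refine Finset.sum_congr rfl fun t _ => Finset.sum_congr rfl fun s _ => ?_
    by_cases hst : s = t
    · simp [hst]
    · rw [Function.update_comm hst]
      simp only [ne_eq, hst, Ne.symm hst, not_false_eq_true, true_and,
        and_comm (a := w s = i)]
  have h4 : ∀ (P : Prop) [Decidable P] (g : Module.End ℂ ((S → Fin n) → ℂ)),
      (if P then g else 0) f w = if P then g f w else 0 := fun P _ g => by
    split_ifs <;> simp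
  simp only [Module.End.mul_apply, LinearMap.sub_apply, LinearMap.add_apply, Pi.sub_apply,
    Pi.add_apply, h4, h1, h2, h3]
  ring

/-- `E_{ij}` and `E_{ji}` are adjoint with respect to the standard Hermitian form. -/
theorem sum_star_mul_wordE (i j : Fin n) (f g : (S → Fin n) → ℂ) :
    ∑ w, star (g w) * wordE S i j f w = ∑ w, star (wordE S j i g w) * f w := by
  simp only [wordE_apply, Finset.mul_sum, star_sum, Finset.sum_mul]
  rw [Finset.sum_comm, Finset.sum_comm (s := Finset.univ (α := S → Fin n))]
  refine Finset.sum_congr rfl fun s _ => ?_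
  have h1 : ∀ w : S → Fin n, (star (g w) * if w s = i then f (Function.update w s j) else 0) =
      if w s = i then star (g w) * f (Function.update w s j) else 0 := fun w => by
    split_ifs <;> simp
  have h2 : ∀ w : S → Fin n, (star (if w s = j then g (Function.update w s i) else 0) * f w) =
      if w s = j then star (g (Function.update w s i)) * f w else 0 := fun w => by
    split_ifs <;> simp
  simp only [h1, h2, ← Finset.sum_filter]
  refine Finset.sum_nbij' (fun w => Function.update w s j) (fun w => Function.update w s i)
    ?_ ?_ ?_ ?_ ?_
  · intro w _; simp
  · intro w _; simp
  · intro w hw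
    simp only [Finset.mem_filter, Finset.mem_univ, true_and] at hw
    simp [← hw]
  · intro w hw
    simp only [Finset.mem_filter, Finset.mem_univ, true_and] at hw
    simp [← hw]
  · intro w hw
    simp only [Finset.mem_filter, Finset.mem_univ, true_and] at hw
    simp [← hw]

theorem card_update {w w' : S → Fin n} {s : S} {k i : Fin n} (hs : w s = k) (hs' : w' s = i)
    (hik : i < k) {l j : Fin n} (hjl : j < l) :
    (Finset.univ.filter fun t => w t = l ∧ w' t = j).card =
      (Finset.univ.filter fun t => Function.update w s i t = l ∧ w' t = j).card +
        if (k, i) = (l, j) then 1 else 0 := by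
  split_ifs with h
  · obtain ⟨rfl, rfl⟩ := Prod.mk.inj h
    rw [← Finset.card_insert_of_notMem (a := s)]
    · congr 1
      ext t
      by_cases hts : t = s
      · subst hts
        simp [hs, hs']
      · simp [hts]
    · simp [hik.ne]
  · rw [add_zero]
    congr 1
    ext t
    by_cases hts : t = s
    · subst hts
      simp only [Finset.mem_filter, Finset.mem_univ, true_and, Function.update_self, hs, hs']
      constructor
      · rintro ⟨rfl, rfl⟩
        exact absurd rfl h
      · rintro ⟨rfl, rfl⟩
        exact absurd hjl (lt_irrefl _)
    · simp [hts]

/-- A product of lowering matrix units, ordered by rows, evaluated at the word `w`: the words `w'`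
that contribute are those with `w' ≤ w` and prescribed numbers of replacements. -/
theorem wordE_list_prod (L : List (Fin n × Fin n)) (hL : L.Pairwise fun p q => p.1 ≤ q.1)
    (hlt : ∀ p ∈ L, p.2 < p.1) (w : S → Fin n) : ∃ c : (S → Fin n) → ℕ,
      (∀ f, (L.map fun p => wordE S p.1 p.2).prod f w = ∑ w', (c w' : ℂ) * f w') ∧
      ∀ w', c w' ≠ 0 ↔ (∀ s, w' s ≤ w s) ∧ ∀ k i, i < k →
        (Finset.univ.filter fun s => w s = k ∧ w' s = i).card = L.count (k, i) := by
  induction L generalizing w with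
  | nil =>
    refine ⟨Pi.single w 1, fun f => ?_, fun w' => ?_⟩
    · rw [Finset.sum_eq_single w]
      · simp
      · intro w' _ h
        simp [Pi.single_eq_of_ne h]
      · simp
    · by_cases h : w' = w
      · subst h
        simp only [Pi.single_eq_same, ne_eq, one_ne_zero, not_false_eq_true, le_refl, implies_true,
          List.count_nil, Finset.card_eq_zero, true_and, true_iff]
        intro k i hik
        refine Finset.filter_eq_empty_iff.2 fun s _ ⟨h1, h2⟩ => ?_
        exact hik.ne (h2.symm.trans h1)
      · simp only [Pi.single_eq_of_ne h, ne_eq, not_true_eq_false, false_iff]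
        rintro ⟨h1, h2⟩
        refine h (funext fun s => (h1 s).eq_of_not_lt fun hlt => ?_)
        have := h2 (w s) (w' s) hlt
        rw [List.count_nil, Finset.card_eq_zero] at this
        have hs : s ∈ Finset.univ.filter fun t => w t = w s ∧ w' t = w' s := by simp
        rw [this] at hs
        simp at hs
  | cons p L ih =>
    obtain ⟨k, i⟩ := p
    have hik : i < k := hlt (k, i) List.mem_cons_self
    rw [List.pairwise_cons] at hL
    choose c hc1 hc2 using ih hL.2 fun p hp => hlt p (List.mem_cons_of_mem _ hp)
    -- The leftmost factor acts on the word first and turns one letter `k` into `i`. The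
    -- coefficients are natural numbers, so contributions cannot cancel.
    refine ⟨fun w' => ∑ s, if w s = k then c (Function.update w s i) w' else 0, fun f => ?_,
      fun w' => ?_⟩
    · rw [List.map_cons, List.prod_cons, Module.End.mul_apply, wordE_apply]
      simp only [hc1]
      push_cast
      simp only [Finset.sum_mul]
      rw [Finset.sum_comm]
      refine Finset.sum_congr rfl fun s _ => ?_
      split_ifs <;> simp
    · have h1 : (∑ s, if w s = k then c (Function.update w s i) w' else 0) ≠ 0 ↔
          ∃ s, w s = k ∧ c (Function.update w s i) w' ≠ 0 := by
        rw [ne_eq, Finset.sum_eq_zero_iff]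
        simp
      rw [h1]
      simp only [hc2]
      constructor
      · rintro ⟨s, hs, hle, hcount⟩
        -- A replaced letter never changes again: this would need a factor of row `i < k` to the
        -- right of a factor of row `k`, against the ordering by rows.
        have hs' : w' s = i := by
          have h2 := hle s
          rw [Function.update_self] at h2
          refine h2.eq_of_not_lt fun h3 => ?_
          have h4 := hcount i (w' s) h3
          have h5 : 0 < L.count (i, w' s) := by
            rw [← h4, Finset.card_pos]
            exact ⟨s, by simp⟩
          exact absurd (hL.1 _ (List.count_pos_iff.1 h5)) (not_le.2 hik)
        refine ⟨fun t => ?_, fun l j hjl => ?_⟩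
        · by_cases hts : t = s
          · subst hts
            rw [hs', hs]
            exact hik.le
          · have := hle t
            rwa [Function.update_of_ne hts] at this
        · rw [card_update hs hs' hik hjl, hcount l j hjl, List.count_cons]
          simp
      · rintro ⟨hle, hcount⟩
        have h2 : 0 < (Finset.univ.filter fun s => w s = k ∧ w' s = i).card := by
          rw [hcount k i hik, List.count_cons_self]
          omega
        obtain ⟨s, hs⟩ := Finset.card_pos.1 h2
        simp only [Finset.mem_filter, Finset.mem_univ, true_and] at hs
        refine ⟨s, hs.1, fun t => ?_, fun l j hjl => ?_⟩
        · by_cases hts : t = s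
          · subst hts
            rw [Function.update_self, hs.2]
          · rw [Function.update_of_ne hts]
            exact hle t
        · have h3 := hcount l j hjl
          rw [card_update hs.1 hs.2 hik hjl, List.count_cons] at h3
          simpa using h3

end Words

/-! ### Highest weight vectors from exterior powers -/

section Columns

variable {n : ℕ}

/-- The sign of `u` as a permutation of `0, …, m - 1`, and `0` if `u` is not a permutation. -/
def colDet {m : ℕ} (u : Fin m → Fin n) : ℂ :=
  (Matrix.of fun r r' : Fin m => if (u r : ℕ) = r' then (1 : ℂ) else 0).det

/-- For `j < m`, replacing a row of `P` by a unit vector gives an entry of the adjugate, so the sum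
is an entry of adj(P) P = det(P) · 1. For `j ≥ m` the replaced row is zero. -/
theorem colDet_update_sum {m : ℕ} (u : Fin m → Fin n) {i j : Fin n} (hij : i ≤ j) :
    (∑ r, if u r = i then colDet (Function.update u r j) else 0) =
      if i = j ∧ (i : ℕ) < m then colDet u else 0 := by
  set P : Matrix (Fin m) (Fin m) ℂ := Matrix.of fun r r' => if (u r : ℕ) = r' then (1 : ℂ) else 0
    with hP
  have hupd : ∀ r, colDet (Function.update u r j) =
      (P.updateRow r fun r' => if (j : ℕ) = r' then (1 : ℂ) else 0).det := fun r => by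
    rw [colDet]
    congr 1
    ext t t'
    by_cases ht : t = r
    · subst ht
      simp
    · simp [ht, hP]
  by_cases hj : (j : ℕ) < m
  · have hi : (i : ℕ) < m := lt_of_le_of_lt hij hj
    have h1 : (fun r' : Fin m => if (j : ℕ) = r' then (1 : ℂ) else 0) = Pi.single ⟨j, hj⟩ 1 := by
      ext r'
      simp [Pi.single_apply, Fin.ext_iff, eq_comm]
    have h2 : (∑ r, if u r = i then colDet (Function.update u r j) else 0) =
        (P.adjugate * P) ⟨j, hj⟩ ⟨i, hi⟩ := by
      rw [Matrix.mul_apply]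
      refine Finset.sum_congr rfl fun r _ => ?_
      rw [hupd, h1, ← Matrix.adjugate_apply, hP, Matrix.of_apply]
      simp only [Fin.ext_iff]
      split_ifs <;> simp
    rw [h2, Matrix.adjugate_mul, Matrix.smul_apply, Matrix.one_apply]
    by_cases h : i = j
    · subst h
      simp only [if_true, smul_eq_mul, mul_one, true_and, if_pos hj]
      rfl
    · have : ¬ ((⟨j, hj⟩ : Fin m) = ⟨i, hi⟩) := fun h' => h (Fin.ext (Fin.mk.inj h').symm)
      simp [h, this]
  · have h0 : ∀ r, colDet (Function.update u r j) = 0 := fun r => by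
      rw [hupd]
      refine Matrix.det_eq_zero_of_row_eq_zero r fun t => ?_
      rw [Matrix.updateRow_self]
      exact if_neg (by omega)
    rw [if_neg (by rintro ⟨rfl, h⟩; exact hj h)]
    exact Finset.sum_eq_zero fun r _ => by rw [h0]; simp

theorem lt_of_colDet_ne_zero {m : ℕ} {u : Fin m → Fin n} (hu : colDet u ≠ 0) (r : Fin m) :
    (u r : ℕ) < m := by
  by_contra hc
  refine hu (Matrix.det_eq_zero_of_row_eq_zero r fun t => ?_)
  exact if_neg (by omega)

theorem injective_of_colDet_ne_zero {m : ℕ} {u : Fin m → Fin n} (hu : colDet u ≠ 0) :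
    Function.Injective u := by
  intro r t hrt
  by_contra hc
  exact hu (Matrix.det_zero_of_row_eq hc (by ext; simp [hrt]))

theorem colDet_of_eq {m : ℕ} {u : Fin m → Fin n} (hu : ∀ r, (u r : ℕ) = r) : colDet u = 1 := by
  rw [colDet, ← Matrix.det_one (n := Fin m)]
  congr 1
  ext r r'
  simp [hu, Matrix.one_apply, Fin.ext_iff]

variable {ι : Type*} [Fintype ι] [DecidableEq ι] {m : ι → ℕ}

/-- The highest weight vector of the tensor product of the exterior powers of degrees `m c`. -/
def columnVector (n : ℕ) (m : ι → ℕ) (w : (Σ c, Fin (m c)) → Fin n) : ℂ :=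
  ∏ c, colDet fun r => w ⟨c, r⟩

theorem wordE_columnVector {i j : Fin n} (hij : i ≤ j) :
    wordE (Σ c, Fin (m c)) i j (columnVector n m) =
      (if i = j then ((Finset.univ.filter fun c => (i : ℕ) < m c).card : ℂ) else 0) •
        columnVector n m := by
  ext w
  rw [wordE_apply, Fintype.sum_sigma]
  have h1 : ∀ c : ι, (∑ r : Fin (m c), if w ⟨c, r⟩ = i then
      columnVector n m (Function.update w ⟨c, r⟩ j) else 0) =
      if i = j ∧ (i : ℕ) < m c then columnVector n m w else 0 := by
    intro c
    have h2 : ∀ r : Fin (m c), columnVector n m (Function.update w ⟨c, r⟩ j) =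
        (∏ d ∈ Finset.univ.erase c, colDet fun t => w ⟨d, t⟩) *
          colDet (Function.update (fun t => w ⟨c, t⟩) r j) := by
      intro r
      rw [columnVector, ← Finset.prod_erase_mul _ _ (Finset.mem_univ c)]
      congr 1
      · refine Finset.prod_congr rfl fun d hd => ?_
        have hdc : d ≠ c := Finset.ne_of_mem_erase hd
        congr 1
        ext t
        rw [Function.update_of_ne]
        intro h
        exact hdc (congrArg Sigma.fst h)
      · congr 1
        ext t
        by_cases h : t = r
        · subst h; simp
        · rw [Function.update_of_ne h, Function.update_of_ne]
          intro h'
          simp at h'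
          exact h h'
    have h3 : ∀ r : Fin (m c), (if w ⟨c, r⟩ = i then
        columnVector n m (Function.update w ⟨c, r⟩ j) else 0) =
        (∏ d ∈ Finset.univ.erase c, colDet fun t => w ⟨d, t⟩) *
          if w ⟨c, r⟩ = i then colDet (Function.update (fun t => w ⟨c, t⟩) r j) else 0 := by
      intro r
      rw [h2]
      split_ifs <;> simp
    simp only [h3]
    rw [← Finset.mul_sum, colDet_update_sum (fun t => w ⟨c, t⟩) hij]
    split_ifs
    · rw [columnVector, ← Finset.prod_erase_mul _ _ (Finset.mem_univ c)]
    · simp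
  rw [Finset.sum_congr rfl fun c _ => h1 c, Pi.smul_apply, smul_eq_mul]
  by_cases h : i = j
  · subst h
    simp [← Finset.sum_filter]
  · simp [h]

end Columns

/-! ### Lexicographic keys and monomials as lists -/

section Keys

variable {n : ℕ}

/-- The entries below the diagonal of an array, as an element of a lexicographic order in which the
last row comes first. -/
def arrKey (A : Fin n → Fin n → ℕ) : Lex (Fin n → Lex (Fin n → ℕ)) :=
  toLex fun k => toLex fun i => if i < k.rev then A k.rev i else 0

theorem arrKey_eq_iff {A B : Fin n → Fin n → ℕ} :
    arrKey A = arrKey B ↔ ∀ k i, i < k → A k i = B k i := by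
  constructor
  · intro h k i hik
    have h1 := congrFun (congrFun h k.rev) i
    simpa [arrKey, hik] using h1
  · intro h
    refine funext fun k => funext fun i => ?_
    by_cases hik : i < k.rev
    · simpa [arrKey, hik] using h _ _ hik
    · simp [arrKey, hik]

theorem arrKey_lt_iff {A B : Fin n → Fin n → ℕ} : arrKey B < arrKey A ↔
    ∃ k : Fin n, (∃ i < k, B k i < A k i ∧ ∀ j < i, B k j = A k j) ∧
      ∀ l, k < l → ∀ j < l, B l j = A l j := by
  constructor
  · rintro ⟨k, h1, i, h2, h3⟩
    refine ⟨k.rev, ⟨i, ?_, ?_, fun j hj => ?_⟩, fun l hl j hj => ?_⟩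
    · by_contra hc
      simp [arrKey, hc] at h3
    · have hc : i < k.rev := by
        by_contra hc
        simp [arrKey, hc] at h3
      simpa [arrKey, hc] using h3
    · have hc : i < k.rev := by
        by_contra hc
        simp [arrKey, hc] at h3
      simpa [arrKey, hj.trans hc] using h2 j hj
    · have := congrFun (h1 l.rev (show l.rev < k by rw [← Fin.rev_lt_rev, Fin.rev_rev]; exact hl)) j
      simpa [arrKey, hj] using this
  · rintro ⟨k, ⟨i, hik, h2, h3⟩, h1⟩
    refine ⟨k.rev, fun l hl => ?_, i, fun j hj => ?_, ?_⟩
    · have hl' : k < l.rev := by rw [← Fin.rev_lt_rev, Fin.rev_rev]; exact hl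
      refine funext fun j => ?_
      by_cases hj : j < l.rev
      · simpa [arrKey, hj] using h1 _ hl' j hj
      · simp [arrKey, hj]
    · simpa [arrKey, hj.trans hik] using h3 j hj
    · simpa [arrKey, hik] using h2

theorem arrKey_lt_of_arrLt {A B : Fin n → Fin n → ℕ} (h : ArrLt n (ofFin B) (ofFin A)) :
    arrKey B < arrKey A := by
  obtain ⟨r, hr, ⟨i, hi, hlt, heq⟩, h2⟩ := h
  rw [arrKey_lt_iff]
  refine ⟨⟨r, hr⟩, ⟨⟨i, by omega⟩, hi, ?_, fun j hj => ?_⟩, fun l hl j hj => ?_⟩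
  · rwa [ofFin_apply _ hr (by omega), ofFin_apply _ hr (by omega)] at hlt
  · have := heq j hj
    rwa [ofFin_apply _ hr (by omega), ofFin_apply _ hr (by omega)] at this
  · simpa using h2 l hl l.2 j hj

/-- The list of the pairs `(k, i)`, `i < k`, ordered by rows, each with multiplicity `A k i`. -/
def pairList (A : Fin n → Fin n → ℕ) : List (Fin n × Fin n) :=
  (List.finRange n).flatMap fun k => ((List.finRange n).filter fun i : Fin n => i < k).flatMap
    fun i => List.replicate (A k i) (k, i)

theorem orderedProd_eq_pairList {M : Type*} [Monoid M] (f : Fin n → Fin n → M)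
    (A : Fin n → Fin n → ℕ) :
    orderedProd (fun k i => f k i ^ A k i) = ((pairList A).map fun p => f p.1 p.2).prod := by
  have key : ∀ {α β : Type} (l : List α) (g : α → List β) (φ : β → M),
      ((l.flatMap g).map φ).prod = (l.map fun a => ((g a).map φ).prod).prod := fun l g φ => by
    induction l with
    | nil => rfl
    | cons a l ih => rw [List.flatMap_cons, List.map_append, List.prod_append, ih]; simp
  rw [orderedProd, pairList, key]
  congr 1
  refine List.map_congr_left fun k _ => ?_
  rw [key]
  congr 1
  refine List.map_congr_left fun i _ => ?_
  simp

theorem pairwise_pairList (A : Fin n → Fin n → ℕ) :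
    (pairList A).Pairwise fun p q => p.1 ≤ q.1 := by
  rw [pairList, List.pairwise_flatMap]
  have hmem : ∀ (k : Fin n), ∀ p ∈ ((List.finRange n).filter fun i : Fin n => i < k).flatMap
      (fun i => List.replicate (A k i) (k, i)), p.1 = k := by
    intro k p hp
    obtain ⟨i, -, hi⟩ := List.mem_flatMap.1 hp
    rw [List.eq_of_mem_replicate hi]
  refine ⟨fun k _ => ?_, ?_⟩
  · exact List.pairwise_of_forall_mem_list fun p hp q hq => by rw [hmem k p hp, hmem k q hq]
  · refine (List.pairwise_lt_finRange n).imp fun {k l} hkl p hp q hq => ?_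
    rw [hmem k p hp, hmem l q hq]
    exact hkl.le

theorem lt_of_mem_pairList {A : Fin n → Fin n → ℕ} {p : Fin n × Fin n} (hp : p ∈ pairList A) :
    p.2 < p.1 := by
  obtain ⟨k, -, hk⟩ := List.mem_flatMap.1 hp
  obtain ⟨i, hi, hi'⟩ := List.mem_flatMap.1 hk
  rw [List.eq_of_mem_replicate hi']
  simpa using (List.mem_filter.1 hi).2

theorem count_pairList (A : Fin n → Fin n → ℕ) {k i : Fin n} (hik : i < k) :
    (pairList A).count (k, i) = A k i := by
  rw [pairList, List.count_flatMap, ← List.sum_toFinset _ (List.nodup_finRange n),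
    Finset.sum_eq_single k]
  · rw [Function.comp_apply, List.count_flatMap,
      ← List.sum_toFinset _ ((List.nodup_finRange n).filter _), Finset.sum_eq_single i]
    · simp
    · intro j _ hj
      simp [List.count_replicate, hj]
    · intro h
      simp [hik] at h
  · intro l _ hl
    rw [Function.comp_apply, List.count_eq_zero]
    intro h
    obtain ⟨j, -, hj⟩ := List.mem_flatMap.1 h
    exact hl (Prod.mk.inj (List.eq_of_mem_replicate hj)).1.symm
  · simp

end Keys

/-! ### Triangularity of evaluation at tableaux -/

section Tableaux

variable {n : ℕ} {ι : Type*} {m : ι → ℕ}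

theorem le_of_column_strict {T : (Σ c, Fin (m c)) → Fin n}
    (hT : ∀ c, ∀ r r' : Fin (m c), r < r' → T ⟨c, r⟩ < T ⟨c, r'⟩) (s : Σ c, Fin (m c)) :
    (s.2 : ℕ) ≤ T s := by
  obtain ⟨c, r, hr⟩ := s
  induction r with
  | zero => exact Nat.zero_le _
  | succ r ih =>
    have h1 := ih (by omega)
    have h2 : (T ⟨c, r, by omega⟩ : ℕ) < T ⟨c, r + 1, hr⟩ := hT c ⟨r, by omega⟩ ⟨r + 1, hr⟩ (by
      rw [Fin.lt_def]
      simp)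
    simp only at h1 ⊢
    omega

variable [Fintype ι]

/-- The number of entries `k` in the row `i` of the tableau `T`. -/
def tableauCount (T : (Σ c, Fin (m c)) → Fin n) (k i : Fin n) : ℕ :=
  (Finset.univ.filter fun s => T s = k ∧ (s.2 : ℕ) = i).card

/-- Let k be the largest letter of `T` on a box where `w` differs from the row index. On boxes with
letter k the value of `w` is at most the row index: otherwise the box of the same column in row `w
s` has a larger letter, so there `w` equals its row, against injectivity of `w` on the column. At
the smallest value of `w` on the deviating boxes with letter k, the count for `w` strictly exceeds
that for `T`. Larger letters, and smaller values for k, have equal counts. -/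
theorem tableauCount_lt {T w : (Σ c, Fin (m c)) → Fin n}
    (hT : ∀ c, ∀ r r' : Fin (m c), r < r' → T ⟨c, r⟩ < T ⟨c, r'⟩)
    (hw : columnVector n m w ≠ 0) (hne : ∃ s, (w s : ℕ) ≠ s.2) :
    arrKey (tableauCount T) <
      arrKey fun k i => (Finset.univ.filter fun s => T s = k ∧ w s = i).card := by
  have hcol : ∀ c, colDet (fun r => w ⟨c, r⟩) ≠ 0 := fun c =>
    (Finset.prod_ne_zero_iff.1 hw) c (Finset.mem_univ c)
  obtain ⟨s0, hs0, hmax⟩ := Finset.exists_max_image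
    (Finset.univ.filter fun s => (w s : ℕ) ≠ s.2) T (by
      obtain ⟨s, hs⟩ := hne
      exact ⟨s, by simpa using hs⟩)
  simp only [Finset.mem_filter, Finset.mem_univ, true_and] at hs0 hmax
  obtain ⟨s1, hs1, hmin⟩ := Finset.exists_min_image
    (Finset.univ.filter fun s => (w s : ℕ) ≠ s.2 ∧ T s = T s0) w ⟨s0, by simpa using hs0⟩
  simp only [Finset.mem_filter, Finset.mem_univ, true_and, and_imp] at hs1 hmin
  have hgood : ∀ s, T s0 < T s → (w s : ℕ) = s.2 := fun s hs => by
    by_contra hc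
    exact absurd (hmax s hc) (not_le.2 hs)
  have hbelow : ∀ s, T s = T s0 → (w s : ℕ) ≤ s.2 := by
    rintro ⟨c, r⟩ hs
    by_contra! hc
    have hlt : (w ⟨c, r⟩ : ℕ) < m c := lt_of_colDet_ne_zero (hcol c) r
    have h1 : T ⟨c, r⟩ < T ⟨c, ⟨w ⟨c, r⟩, hlt⟩⟩ := hT c _ _ hc
    have h2 := hgood _ (hs ▸ h1)
    have h3 := injective_of_colDet_ne_zero (hcol c) (Fin.ext h2)
    have h4 := congrArg Fin.val h3
    simp only at h4 hc
    omega
  rw [arrKey_lt_iff]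
  refine ⟨T s0, ⟨w s1, ?_, ?_, fun j hj => ?_⟩, fun l hl j _ => ?_⟩
  · rw [← hs1.2, Fin.lt_def]
    exact lt_of_lt_of_le (lt_of_le_of_ne (hbelow s1 hs1.2) hs1.1) (le_of_column_strict hT s1)
  · refine Finset.card_lt_card (Finset.ssubset_iff_of_subset ?_ |>.2 ⟨s1, ?_, ?_⟩)
    · intro s hs
      simp only [Finset.mem_filter, Finset.mem_univ, true_and] at hs ⊢
      refine ⟨hs.1, ?_⟩
      by_contra hc
      have h1 := hbelow s hs.1
      have h2 : (w s : ℕ) ≠ s.2 := fun h => hc (Fin.ext (h.trans hs.2))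
      have h3 := hmin s h2 hs.1
      rw [Fin.le_def] at h3
      omega
    · simpa using hs1.2
    · simp only [Finset.mem_filter, Finset.mem_univ, true_and, not_and]
      exact fun _ h => hs1.1 h.symm
  · rw [tableauCount]
    congr 1
    ext s
    simp only [Finset.mem_filter, Finset.mem_univ, true_and]
    refine and_congr_right fun hs => ?_
    have h1 := hbelow s hs
    have h2 := hmin s
    rw [Fin.lt_def] at hj
    simp only [Fin.le_def, Fin.ext_iff] at h2 ⊢
    constructor
    · intro h
      by_contra hc
      have := h2 (by omega) (by rw [hs])
      omega
    · intro h
      by_contra hc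
      have := h2 (by omega) (by rw [hs])
      omega
  · rw [tableauCount]
    congr 1
    ext s
    simp only [Finset.mem_filter, Finset.mem_univ, true_and]
    refine and_congr_right fun hs => ?_
    rw [Fin.ext_iff, hgood s (hs ▸ hl)]

variable [DecidableEq ι] {T : (Σ c, Fin (m c)) → Fin n}
  (hT : ∀ c, ∀ r r' : Fin (m c), r < r' → T ⟨c, r⟩ < T ⟨c, r'⟩)

include hT

/-- A contributing word has replacement numbers `A`, and their key is never below that of `T` by
`tableauCount_lt`. -/
theorem monomial_columnVector_eq_zero {A : Fin n → Fin n → ℕ}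
    (hA : arrKey A < arrKey (tableauCount T)) :
    orderedProd (fun k i => wordE (Σ c, Fin (m c)) k i ^ A k i) (columnVector n m) T = 0 := by
  obtain ⟨c, hc1, hc2⟩ := wordE_list_prod (pairList A) (pairwise_pairList A)
    (fun _ => lt_of_mem_pairList) T
  rw [orderedProd_eq_pairList, hc1]
  refine Finset.sum_eq_zero fun w _ => ?_
  by_contra h0
  have h1 := (hc2 w).1 (Nat.cast_ne_zero.1 (left_ne_zero_of_mul h0))
  have hcount : (arrKey fun k i => (Finset.univ.filter fun s => T s = k ∧ w s = i).card) =
      arrKey A := arrKey_eq_iff.2 fun k i hik => by rw [h1.2 k i hik, count_pairList A hik]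
  by_cases hw : ∃ s, (w s : ℕ) ≠ s.2
  · have := tableauCount_lt hT (right_ne_zero_of_mul h0) hw
    rw [hcount] at this
    exact lt_asymm this hA
  · push Not at hw
    refine hA.ne (hcount.symm.trans (arrKey_eq_iff.2 fun k i _ => ?_))
    simp only [tableauCount, Fin.ext_iff, hw]

theorem monomial_columnVector_ne_zero {A : Fin n → Fin n → ℕ}
    (hA : arrKey A = arrKey (tableauCount T)) :
    orderedProd (fun k i => wordE (Σ c, Fin (m c)) k i ^ A k i) (columnVector n m) T ≠ 0 := by
  obtain ⟨c, hc1, hc2⟩ := wordE_list_prod (pairList A) (pairwise_pairList A)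
    (fun _ => lt_of_mem_pairList) T
  -- The word of row indices. It is the only word in the support of the column vector whose
  -- replacement numbers have the key of `T`.
  let w0 : (Σ c, Fin (m c)) → Fin n := fun s =>
    ⟨s.2, lt_of_le_of_lt (le_of_column_strict hT s) (T s).2⟩
  rw [orderedProd_eq_pairList, hc1, Finset.sum_eq_single w0]
  · refine mul_ne_zero (Nat.cast_ne_zero.2 ((hc2 w0).2 ⟨le_of_column_strict hT, fun k i hik => ?_⟩))
      (Finset.prod_ne_zero_iff.2 fun d _ => ?_)
    · rw [count_pairList A hik, arrKey_eq_iff.1 hA k i hik]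
      simp only [tableauCount, Fin.ext_iff, w0]
    · rw [colDet_of_eq (u := fun r => w0 ⟨d, r⟩) fun r => rfl]
      exact one_ne_zero
  · intro w _ hw
    by_contra h0
    have h1 := (hc2 w).1 (Nat.cast_ne_zero.1 (left_ne_zero_of_mul h0))
    have h2 := tableauCount_lt hT (right_ne_zero_of_mul h0) (by
      by_contra! hc
      exact hw (funext fun s => Fin.ext (hc s)))
    rw [← hA] at h2
    refine h2.ne (arrKey_eq_iff.2 fun k i hik => ?_)
    rw [h1.2 k i hik, count_pairList A hik]
  · exact fun h => absurd (Finset.mem_univ _) h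

end Tableaux

/-! ### Transfer of linear relations to words -/

section Transfer

variable {n : ℕ} {V : Type*} [AddCommGroup V] [Module ℂ V] [LieRingModule (gl n) V]
  [LieModule ℂ (gl n) V] {S : Type*} [Fintype S] [DecidableEq S]

variable (S) in
/-- The matrix unit `E_{ij}` acting on functions on words, twisted by `c` times the trace. -/
def twistedE (c : ℂ) (i j : Fin n) : Module.End ℂ ((S → Fin n) → ℂ) :=
  wordE S i j + if i = j then c • 1 else 0

theorem twistedE_of_ne {c : ℂ} {i j : Fin n} (h : i ≠ j) : twistedE S c i j = wordE S i j := by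
  simp [twistedE, h]

theorem twistedE_mul (c : ℂ) (i j k l : Fin n) : twistedE S c i j * twistedE S c k l =
    twistedE S c k l * twistedE S c i j +
    (if j = k then twistedE S c i l else 0) - (if l = i then twistedE S c k j else 0) := by
  have h1 : ∀ i j k l : Fin n, twistedE S c i j * twistedE S c k l = wordE S i j * wordE S k l +
      (if k = l then c • wordE S i j else 0) + (if i = j then c • wordE S k l else 0) +
      (if i = j then if k = l then (c * c) • 1 else 0 else 0) := fun i j k l => by
    simp only [twistedE]
    split_ifs <;> simp [add_mul, mul_add, smul_smul]
    abel
  rw [h1, h1, wordE_mul]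
  have h2 : (if j = k then twistedE S c i l else 0) - (if l = i then twistedE S c k j else 0) =
      (if j = k then wordE S i l else 0) - (if l = i then wordE S k j else 0) := by
    simp only [twistedE]
    by_cases hjk : j = k <;> by_cases hli : l = i
    · subst hjk; subst hli
      simp
    · simp [hjk, hli, Ne.symm hli]
    · simp [hjk, hli, Ne.symm hjk]
    · simp [hjk, hli]
  rw [add_sub_assoc, add_sub_assoc, h2]
  split_ifs <;> abel

variable (V S) in
/-- The matrix unit `E_{ij}` acting on the direct sum of `V` and the twisted module of functions on
words. -/
def pairE (c : ℂ) (i j : Fin n) : Module.End ℂ (V × ((S → Fin n) → ℂ)) :=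
  (E V i j).prodMap (twistedE S c i j)

theorem pairE_pairE_apply (c : ℂ) (i j k l : Fin n) (x : V × ((S → Fin n) → ℂ)) :
    pairE V S c i j (pairE V S c k l x) = pairE V S c k l (pairE V S c i j x) +
    (if j = k then pairE V S c i l x else 0) - (if l = i then pairE V S c k j x else 0) := by
  have h1 := congrArg (fun f => f x.1) (E_mul_E V i j k l)
  have h2 := congrArg (fun f => f x.2) (twistedE_mul (S := S) c i j k l)
  simp only [Module.End.mul_apply, LinearMap.sub_apply, LinearMap.add_apply] at h1 h2
  refine Prod.ext ?_ ?_
  · refine h1.trans ?_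
    split_ifs <;> simp [pairE]
  · refine h2.trans ?_
    split_ifs <;> simp [pairE]

theorem star_dotProduct_wordE (i j : Fin n) (f g : (S → Fin n) → ℂ) :
    star g ⬝ᵥ wordE S i j f = star (wordE S j i g) ⬝ᵥ f :=
  sum_star_mul_wordE i j f g

variable {lam : Fin n → ℂ} {c : ℂ} {v : V} {u : (S → Fin n) → ℂ}

/-- The submodule of the direct sum generated by the pair of highest weight vectors. -/
def pairHull (c : ℂ) (v : V) (u : (S → Fin n) → ℂ) : Submodule ℂ (V × ((S → Fin n) → ℂ)) :=
  hull {f | ∃ i j : Fin n, j < i ∧ f = pairE V S c i j} {(v, u)}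

/-- The hull is formed with lowering operators only. The pair is a highest weight vector, and the
commutators with lowering operators give closure under all matrix units. -/
theorem pairE_mem_pairHull (hv : IsHighestWeightVector lam v)
    (hu : ∀ i j : Fin n, i < j → wordE S i j u = 0)
    (hu' : ∀ i : Fin n, twistedE S c i i u = lam i • u) (i j : Fin n)
    {x : V × ((S → Fin n) → ℂ)} (hx : x ∈ pairHull c v u) :
    pairE V S c i j x ∈ pairHull c v u := by
  set N := pairHull (S := S) c v u with hN
  have hlow : ∀ i j : Fin n, j < i → ∀ x ∈ N, pairE V S c i j x ∈ N := fun i j hij x hx => by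
    refine apply_mem_hull ?_ hx
    exact ⟨i, j, hij, rfl⟩
  let Q : Submodule ℂ (V × ((S → Fin n) → ℂ)) :=
    { carrier := {y | y ∈ N ∧ ∀ i j : Fin n, i ≤ j → pairE V S c i j y ∈ N}
      add_mem' := fun hx hy => ⟨N.add_mem hx.1 hy.1, fun i j hij => by
        rw [map_add]; exact N.add_mem (hx.2 i j hij) (hy.2 i j hij)⟩
      zero_mem' := ⟨N.zero_mem, fun i j _ => by rw [map_zero]; exact N.zero_mem⟩
      smul_mem' := fun r x hx => ⟨N.smul_mem r hx.1, fun i j hij => by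
        rw [map_smul]; exact N.smul_mem r (hx.2 i j hij)⟩ }
  have hall : ∀ x ∈ Q, ∀ i j, pairE V S c i j x ∈ N := fun x hx i j => by
    rcases lt_or_ge j i with h | h
    · exact hlow i j h x hx.1
    · exact hx.2 i j h
  have hQ : N ≤ Q := by
    refine hull_le ?_ ?_
    · rw [Set.singleton_subset_iff]
      have h0 : (v, u) ∈ N := subset_hull _ _ rfl
      refine ⟨h0, fun i j hij => ?_⟩
      rcases hij.lt_or_eq with h | rfl
      · have : pairE V S c i j (v, u) = 0 := by
          simp [pairE, hv.raise i j h, twistedE_of_ne h.ne, hu i j h]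
        rw [this]
        exact N.zero_mem
      · have : pairE V S c i i (v, u) = lam i • (v, u) := by
          simp [pairE, hv.weight, hu']
        rw [this]
        exact N.smul_mem _ h0
    · rintro f ⟨k, l, hkl, rfl⟩ x hx
      refine ⟨hlow k l hkl x hx.1, fun i j hij => ?_⟩
      rw [pairE_pairE_apply]
      refine N.sub_mem (N.add_mem (hlow k l hkl _ (hx.2 i j hij)) ?_) ?_
      · split_ifs
        · exact hall x hx i l
        · exact N.zero_mem
      · split_ifs
        · exact hall x hx k j
        · exact N.zero_mem
  exact hall x (hQ hx) i j

/-- Lowering operators strictly increase the eigenvalue of `D`, the sum of i E_{ii}. In the words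
their images are orthogonal to `u`, because the adjoint raising operators kill `u`. So every element
of the hull is a multiple r (v, u) plus an element of `L.prod U`, and a zero first coordinate forces
r = 0. -/
theorem dotProduct_eq_zero_of_mem_pairHull (hv : IsHighestWeightVector lam v)
    (hu : ∀ i j : Fin n, i < j → wordE S i j u = 0) {y : (S → Fin n) → ℂ}
    (hy : ((0 : V), y) ∈ pairHull c v u) : star u ⬝ᵥ y = 0 := by
  let D : Module.End ℂ V := ∑ i : Fin n, ((i : ℕ) : ℂ) • E V i i
  let d : ℂ := ∑ i : Fin n, ((i : ℕ) : ℂ) * lam i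
  have hD : ∀ k l : Fin n, ∀ x, D (E V k l x) = E V k l (D x) +
      (((k : ℕ) : ℂ) - ((l : ℕ) : ℂ)) • E V k l x := by
    intro k l x
    have h1 : ∀ i, E V i i (E V k l x) = E V k l (E V i i x) + (if i = k then E V i l x else 0) -
        (if l = i then E V k i x else 0) := fun i => by
      have := congrArg (fun f => f x) (E_mul_E V i i k l)
      simp only [Module.End.mul_apply, LinearMap.sub_apply, LinearMap.add_apply] at this
      rw [this]
      split_ifs <;> simp
    simp only [D, LinearMap.sum_apply, LinearMap.smul_apply, h1, smul_sub, smul_add,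
      Finset.sum_sub_distrib, Finset.sum_add_distrib, map_sum, map_smul, smul_ite, smul_zero,
      Finset.sum_ite_eq', Finset.sum_ite_eq, Finset.mem_univ, if_true, sub_smul]
    abel
  have hDv : D v = d • v := by
    simp only [D, d, LinearMap.sum_apply, LinearMap.smul_apply, hv.weight, smul_smul,
      Finset.sum_smul]
  let L : Submodule ℂ V := ⨆ r : ℕ, D.eigenspace (d + (r + 1 : ℕ))
  have hL : ∀ k l : Fin n, l < k → ∀ x ∈ L, E V k l x ∈ L := by
    intro k l hlk x hx
    have : L ≤ L.comap (E V k l) := by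
      refine iSup_le fun r y hy => ?_
      refine Submodule.mem_iSup_of_mem (r + ((k : ℕ) - l)) ?_
      rw [Module.End.mem_eigenspace_iff] at hy ⊢
      rw [hD, hy, map_smul]
      have : ((k : ℕ) : ℂ) - ((l : ℕ) : ℂ) = (((k : ℕ) - l : ℕ) : ℂ) := by
        rw [Nat.cast_sub (show (l : ℕ) ≤ k from hlk.le)]
      rw [this]
      push_cast
      module
    exact this hx
  have hvL : ∀ k l : Fin n, l < k → E V k l v ∈ L := by
    intro k l hlk
    have hlk' : (l : ℕ) < k := hlk
    refine Submodule.mem_iSup_of_mem ((k : ℕ) - l - 1) ?_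
    rw [Module.End.mem_eigenspace_iff, hD, hDv, map_smul]
    have : ((k : ℕ) : ℂ) - ((l : ℕ) : ℂ) = ((((k : ℕ) - l - 1) + 1 : ℕ) : ℂ) := by
      rw [Nat.sub_add_cancel (by omega), Nat.cast_sub hlk'.le]
    rw [this]
    module
  have hdisj : Disjoint (D.eigenspace d) L := by
    refine (Module.End.eigenspaces_iSupIndep D d).mono_right (iSup_le fun r => ?_)
    refine le_iSup₂_of_le (d + (r + 1 : ℕ)) ?_ le_rfl
    intro h
    have h1 : ((r + 1 : ℕ) : ℂ) = 0 := by linear_combination h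
    exact Nat.cast_ne_zero.2 r.succ_ne_zero h1
  let U : Submodule ℂ ((S → Fin n) → ℂ) :=
    { carrier := {y | star u ⬝ᵥ y = 0}
      add_mem' := fun {x y} hx hy => by
        simp only [Set.mem_ofPred_eq] at hx hy ⊢
        rw [dotProduct_add, hx, hy, add_zero]
      zero_mem' := dotProduct_zero _
      smul_mem' := fun r x hx => by
        simp only [Set.mem_ofPred_eq] at hx ⊢
        rw [dotProduct_smul, hx, smul_zero] }
  have hU : ∀ k l : Fin n, l < k → ∀ y, twistedE S c k l y ∈ U := by
    intro k l hlk y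
    change star u ⬝ᵥ twistedE S c k l y = 0
    rw [twistedE_of_ne hlk.ne', star_dotProduct_wordE, hu l k hlk, star_zero, zero_dotProduct]
  have hP : pairHull c v u ≤ Submodule.span ℂ {(v, u)} ⊔ L.prod U := by
    refine hull_le ?_ ?_
    · exact fun x hx => Submodule.mem_sup_left (Submodule.subset_span hx)
    · rintro f ⟨k, l, hlk, rfl⟩ x hx
      refine Submodule.mem_sup_right ?_
      obtain ⟨y, hy, x', hx', rfl⟩ := Submodule.mem_sup.1 hx
      obtain ⟨r, rfl⟩ := Submodule.mem_span_singleton.1 hy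
      refine ⟨?_, hU k l hlk _⟩
      change E V k l (r • v + x'.1) ∈ L
      rw [map_add, map_smul]
      exact L.add_mem (L.smul_mem r (hvL k l hlk)) (hL k l hlk _ hx'.1)
  obtain ⟨y1, hy1, x, hx, hxy⟩ := Submodule.mem_sup.1 (hP hy)
  obtain ⟨r, rfl⟩ := Submodule.mem_span_singleton.1 hy1
  have h1 : r • v + x.1 = 0 := congrArg Prod.fst hxy
  have h2 : r • u + x.2 = y := congrArg Prod.snd hxy
  have h3 : r • v ∈ L := by
    rw [eq_neg_of_add_eq_zero_left h1]
    exact L.neg_mem hx.1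
  have h4 : r • v ∈ D.eigenspace d :=
    Submodule.smul_mem _ _ (Module.End.mem_eigenspace_iff.2 hDv)
  have h5 := (Submodule.disjoint_def.1 hdisj) _ h4 h3
  have h6 : r = 0 := (smul_eq_zero.1 h5).resolve_right hv.ne_zero
  rw [← h2, h6, zero_smul, zero_add]
  exact hx.2

open scoped ComplexOrder in
-- The `y` with (0, y) in the hull form a subspace stable under raising operators. By adjointness,
-- orthogonality to this subspace passes from `u` to all second coordinates of the hull. The
-- subspace is then orthogonal to itself, hence zero by positivity: the hull is the graph of a
-- linear map on its first projection.
theorem eq_zero_of_mem_pairHull (hv : IsHighestWeightVector lam v)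
    (hu : ∀ i j : Fin n, i < j → wordE S i j u = 0)
    (hu' : ∀ i : Fin n, twistedE S c i i u = lam i • u) {y : (S → Fin n) → ℂ}
    (hy : ((0 : V), y) ∈ pairHull c v u) : y = 0 := by
  let Q : Submodule ℂ (V × ((S → Fin n) → ℂ)) :=
    { carrier := {x | ∀ y, ((0 : V), y) ∈ pairHull c v u → star x.2 ⬝ᵥ y = 0}
      add_mem' := fun {x x'} hx hx' y hy => by
        rw [Prod.snd_add, star_add, add_dotProduct, hx y hy, hx' y hy, add_zero]
      zero_mem' := fun y _ => by rw [Prod.snd_zero, star_zero, zero_dotProduct]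
      smul_mem' := fun r x hx y hy => by
        rw [Prod.smul_snd, star_smul, smul_dotProduct, hx y hy, smul_zero] }
  have hQ : pairHull c v u ≤ Q := by
    refine hull_le ?_ ?_
    · rw [Set.singleton_subset_iff]
      exact fun y hy => dotProduct_eq_zero_of_mem_pairHull hv hu hy
    · rintro f ⟨k, l, hlk, rfl⟩ x hx y hy
      change star (twistedE S c k l x.2) ⬝ᵥ y = 0
      rw [twistedE_of_ne hlk.ne', ← star_dotProduct_wordE]
      refine hx _ ?_
      have := pairE_mem_pairHull hv hu hu' l k hy
      simpa [pairE, twistedE_of_ne hlk.ne] using this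
  exact dotProduct_star_self_eq_zero.1 (hQ hy y hy)

theorem orderedProd_map {M M' F : Type*} [Monoid M] [Monoid M'] [FunLike F M M']
    [MonoidHomClass F M M'] (φ : F) (f : Fin n → Fin n → M) :
    φ (orderedProd f) = orderedProd fun k i => φ (f k i) := by
  simp only [orderedProd, map_list_prod, List.map_map]
  congr 1
  refine List.map_congr_left fun k _ => ?_
  simp only [Function.comp_apply, map_list_prod, List.map_map]
  rfl

theorem monomial_mem_pairHull (hv : IsHighestWeightVector lam v)
    (hu : ∀ i j : Fin n, i < j → wordE S i j u = 0)
    (hu' : ∀ i : Fin n, twistedE S c i i u = lam i • u) (A : Fin n → Fin n → ℕ) :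
    (orderedProd (fun k i => E V k i ^ A k i) v,
      orderedProd (fun k i => wordE S k i ^ A k i) u) ∈ pairHull c v u := by
  have h1 : orderedProd (fun k i => pairE V S c k i ^ A k i) ∈
      stabilizer (pairHull (S := S) c v u) := by
    rw [orderedProd_eq_pairList]
    refine Subalgebra.list_prod_mem _ fun f hf => ?_
    obtain ⟨p, -, rfl⟩ := List.mem_map.1 hf
    exact fun x hx => pairE_mem_pairHull hv hu hu' p.1 p.2 hx
  have h2 := h1 _ (subset_hull _ _ rfl)
  have h3 : orderedProd (fun k i => pairE V S c k i ^ A k i) =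
      (orderedProd fun k i => E V k i ^ A k i).prodMap
        (orderedProd fun k i => wordE S k i ^ A k i) := by
    have h4 := orderedProd_map (LinearMap.prodMapRingHom ℂ V ((S → Fin n) → ℂ)) (fun k i =>
      ((E V k i, twistedE S c k i) : Module.End ℂ V × Module.End ℂ ((S → Fin n) → ℂ)) ^ A k i)
    have h5 := orderedProd_map (RingHom.fst (Module.End ℂ V) (Module.End ℂ ((S → Fin n) → ℂ)))
      (fun k i => ((E V k i, twistedE S c k i) :
        Module.End ℂ V × Module.End ℂ ((S → Fin n) → ℂ)) ^ A k i)
    have h6 := orderedProd_map (RingHom.snd (Module.End ℂ V) (Module.End ℂ ((S → Fin n) → ℂ)))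
      (fun k i => ((E V k i, twistedE S c k i) :
        Module.End ℂ V × Module.End ℂ ((S → Fin n) → ℂ)) ^ A k i)
    simp only [map_pow] at h4 h5 h6
    have h7 : orderedProd (fun k i => twistedE S c k i ^ A k i) =
        orderedProd fun k i => wordE S k i ^ A k i := by
      rw [orderedProd_eq_pairList, orderedProd_eq_pairList]
      congr 1
      exact List.map_congr_left fun p hp => twistedE_of_ne (lt_of_mem_pairList hp).ne'
    rw [← h7]
    refine h4.symm.trans ?_
    change LinearMap.prodMap (orderedProd _ : _ × _).1 (orderedProd _ : _ × _).2 = _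
    exact congrArg₂ LinearMap.prodMap h5 h6
  rw [h3] at h2
  exact h2

theorem monomial_sum_eq_zero (hv : IsHighestWeightVector lam v)
    (hu : ∀ i j : Fin n, i < j → wordE S i j u = 0)
    (hu' : ∀ i : Fin n, twistedE S c i i u = lam i • u) {ι : Type*} (s : Finset ι) (g : ι → ℂ)
    (A : ι → Fin n → Fin n → ℕ)
    (h : ∑ x ∈ s, g x • orderedProd (fun k i => E V k i ^ A x k i) v = 0) :
    ∑ x ∈ s, g x • orderedProd (fun k i => wordE S k i ^ A x k i) u = 0 := by
  refine eq_zero_of_mem_pairHull (V := V) (c := c) hv hu hu' ?_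
  have h1 := (pairHull (S := S) c v u).sum_mem fun x (_ : x ∈ s) =>
    (pairHull (S := S) c v u).smul_mem (g x) (monomial_mem_pairHull hv hu hu' (A x))
  convert h1 using 1
  refine Prod.ext ?_ ?_
  · rw [Prod.fst_sum]
    exact h.symm
  · rw [Prod.snd_sum]
    rfl

end Transfer

/-! ### Patterns and admissible exponents -/

section Patterns

variable {n : ℕ} {lam : Fin n → ℂ}

/-- The extension of a weight by zero. -/
def extendWeight (lam : Fin n → ℂ) (i : ℕ) : ℂ := if h : i < n then lam ⟨i, h⟩ else 0

theorem extendWeight_val (lam : Fin n → ℂ) (i : Fin n) : extendWeight lam i = lam i := dif_pos i.2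

theorem IsDominant.isNat (hlam : IsDominant lam) (l : ℕ) (hl : l + 1 < n) :
    IsNat (extendWeight lam l - extendWeight lam (l + 1)) := by
  rw [extendWeight, extendWeight, dif_pos hl, dif_pos (by omega)]
  exact hlam _ _ rfl

theorem Pattern.adm_of_entry (P : Pattern lam) {k : ℕ} (hk : k ≤ n) {mu : ℕ → ℂ}
    (hmu : ∀ i l (hi : i < k) (hl : l + 1 = k), mu i = P.entry ⟨l, by omega⟩ ⟨i, by omega⟩) :
    Adm k mu (ofFin P.diff) := by
  induction k generalizing mu with
  | zero => trivial
  | succ k ih =>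
    have hdiff : ∀ i (hi : i < k), mu i - (ofFin P.diff k i : ℕ) =
        P.entry ⟨k - 1, by omega⟩ ⟨i, by omega⟩ := fun i hi => by
      rw [ofFin_apply _ (by omega) (by omega), P.natCast_diff (show _ < _ from hi),
        hmu i k (by omega) rfl]
      exact sub_sub_cancel _ _
    refine ⟨fun i hi => ?_, ih (by omega) fun i l hi hl => ?_⟩
    · rw [sub_right_comm, hdiff i hi, hmu (i + 1) k (by omega) rfl]
      exact (P.between ⟨k, by omega⟩ ⟨k - 1, by omega⟩ ⟨i, by omega⟩ ⟨i + 1, by omega⟩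
        (by simp only; omega) rfl (by rw [Fin.le_def]; exact hi)).2
    · subst hl
      exact hdiff i hi

theorem Pattern.adm (P : Pattern lam) : Adm n (extendWeight lam) (ofFin P.diff) :=
  P.adm_of_entry le_rfl fun i l hi hl => by
    rw [P.top _ _ hl, extendWeight, dif_pos hi]

theorem exists_pattern_of_adm {A : ℕ → ℕ → ℕ} (hA : Adm n (extendWeight lam) A) :
    ∃ P : Pattern lam, ∀ k i : Fin n, i < k → P.diff k i = A k i := by
  -- `wt k` is the row with `k` entries, numbered `k - 1` in the pattern: the weight left after
  -- subtracting the exponents of the rows from `k` on.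
  let wt : ℕ → ℕ → ℂ := fun k i => extendWeight lam i - ∑ l ∈ Finset.Ico k n, (A l i : ℂ)
  have hstep : ∀ k < n, ∀ i, wt k i = wt (k + 1) i - A k i := fun k hk i => by
    simp only [wt]
    rw [Finset.sum_eq_sum_Ico_succ_bot hk]
    ring
  have hadm : ∀ k, k ≤ n → Adm (n - k) (wt (n - k)) A := by
    intro k
    induction k with
    | zero =>
      intro _
      simpa [wt] using hA
    | succ k ih =>
      intro hk
      have h1 := ih (by omega)
      obtain ⟨l, hl⟩ : ∃ l, n - k = l + 1 := ⟨n - k - 1, by omega⟩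
      rw [hl] at h1
      rw [show n - (k + 1) = l by omega, show wt l = fun i => wt (l + 1) i - A l i from
        funext (hstep l (by omega))]
      exact h1.2
  have hnat : ∀ k < n, ∀ i < k, IsNat (wt (k + 1) i - wt (k + 1) (i + 1) - A k i) := by
    intro k hk i hi
    have := hadm (n - (k + 1)) (by omega)
    rw [show n - (n - (k + 1)) = k + 1 by omega] at this
    exact this.1 i hi
  let P : Pattern lam :=
    { entry := fun k i => if i ≤ k then wt (k + 1) i else 0
      zeros := fun k i hki => if_neg (not_le.2 hki)
      top := fun k i hk => by
        rw [if_pos (by rw [Fin.le_def]; omega), hk]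
        simp [wt, extendWeight_val]
      between := fun k l i j hl hj hjk => by
        rw [Fin.le_def] at hjk
        rw [if_pos (show i ≤ k by rw [Fin.le_def]; omega),
          if_pos (show i ≤ l by rw [Fin.le_def]; omega), if_pos (show j ≤ k from hjk), hl, ← hj,
          hstep k k.2]
        refine ⟨⟨A k i, by ring⟩, ?_⟩
        have := hnat k k.2 i (by omega)
        rwa [sub_right_comm] at this }
  refine ⟨P, fun k i hik => ?_⟩
  have hik' : (i : ℕ) < k := hik
  have h1 := P.natCast_diff hik
  have h2 : P.entry k i = wt (k + 1) i := if_pos hik.le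
  have h3 : P.entry ⟨(k : ℕ) - 1, by omega⟩ i = wt k i := by
    have : ((k : ℕ) - 1) + 1 = k := by omega
    change (if i ≤ ⟨(k : ℕ) - 1, _⟩ then wt (((k : ℕ) - 1) + 1) i else 0) = _
    rw [if_pos (by rw [Fin.le_def]; simp only; omega), this]
  rw [h2, h3, hstep k k.2] at h1
  have h4 : ((P.diff k i : ℕ) : ℂ) = (A k i : ℕ) := by rw [h1]; ring
  exact_mod_cast h4

/-- The top row is fixed, and the differences determine each shorter row from the next longer one.
-/
theorem Pattern.arrKey_injective : Function.Injective fun P : Pattern lam => arrKey P.diff := by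
  intro P Q h
  have h := arrKey_eq_iff.1 h
  have key : ∀ m : ℕ, ∀ k i : Fin n, (k : ℕ) + 1 + m = n → i ≤ k → P.entry k i = Q.entry k i := by
    intro m
    induction m with
    | zero => exact fun k i hk _ => by rw [P.top k i hk, Q.top k i hk]
    | succ m ih =>
      intro k i hk hik
      rw [Fin.le_def] at hik
      have hik' : i < (⟨k + 1, by omega⟩ : Fin n) := by rw [Fin.lt_def]; simp only; omega
      have h1 := P.natCast_diff hik'
      have h2 := Q.natCast_diff hik'
      rw [h _ _ hik', h2, ih ⟨k + 1, by omega⟩ i (by simp only; omega) hik'.le] at h1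
      exact (sub_right_injective h1).symm
  ext k i
  rcases le_or_gt i k with hik | hik
  · exact key (n - (k + 1)) k i (by omega) hik
  · rw [P.zeros k i hik, Q.zeros k i hik]

/-- The last entry of `lam` serves as `c`: interlacing leads diagonally from any entry to one of the
top row, decreasing by natural numbers. -/
theorem exists_isNat_entry_sub (hlam : IsDominant lam) :
    ∃ c : ℂ, (∀ i, IsNat (lam i - c)) ∧
      ∀ (P : Pattern lam) (k i : Fin n), i ≤ k → IsNat (P.entry k i - c) := by
  rcases n with _ | n
  · exact ⟨0, fun i => i.elim0, fun P k => k.elim0⟩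
  have htop : ∀ i, IsNat (lam i - lam (Fin.last n)) := fun i => by
    have := isNat_sub_of_le hlam.isNat (show (i : ℕ) ≤ (Fin.last n : ℕ) from Fin.le_last i)
      (Fin.last n).2
    rwa [extendWeight_val, extendWeight_val] at this
  refine ⟨lam (Fin.last n), htop, fun P => ?_⟩
  have key : ∀ m : ℕ, ∀ k i : Fin (n + 1), (k : ℕ) + 1 + m = n + 1 → i ≤ k →
      IsNat (P.entry k i - lam (Fin.last n)) := by
    intro m
    induction m with
    | zero =>
      intro k i hk _
      rw [P.top k i hk]
      exact htop i
    | succ m ih =>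
      intro k i hk hik
      rw [Fin.le_def] at hik
      have h1 := (P.between ⟨k + 1, by omega⟩ k i ⟨i + 1, by omega⟩ rfl rfl (by
        rw [Fin.le_def]; simp only; omega)).2
      have h2 := ih ⟨k + 1, by omega⟩ ⟨i + 1, by omega⟩ (by simp only; omega) (by
        rw [Fin.le_def]; simp only; omega)
      have := h1.add h2
      rwa [sub_add_sub_cancel] at this
  exact fun k i hik => key (n - k) k i (by omega) hik

end Patterns

/-! ### From patterns to column-strict tableaux -/

section ColumnHeights

/-- The length of the column `x` of the diagram with the rows `mu 0, …, mu (n - 1)`. -/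
def columnHeight {n : ℕ} (mu : ℕ → ℕ) {M : ℕ} (x : Fin M) : ℕ :=
  Nat.find (p := fun i => n ≤ i ∨ mu i ≤ x) ⟨n, Or.inl le_rfl⟩

theorem lt_columnHeight {n : ℕ} {mu : ℕ → ℕ} (hmu : ∀ i j, i ≤ j → j < n → mu j ≤ mu i) {M : ℕ}
    {x : Fin M} {i : ℕ} : i < columnHeight (n := n) mu x ↔ i < n ∧ (x : ℕ) < mu i := by
  rw [columnHeight, Nat.lt_find_iff]
  constructor
  · intro h
    have := h i le_rfl
    omega
  · rintro ⟨h1, h2⟩ j hj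
    have := hmu j i hj h1
    omega

end ColumnHeights

section PatternTableau

variable {n M : ℕ} {mu : ℕ → ℕ} {N A : ℕ → ℕ → ℕ}

/-- A chain of interlacing rows `N k` with the differences `A k` and the last row `mu` is recorded
by a tableau that is strictly increasing in the columns. -/
theorem exists_tableau (hmu : ∀ i j, i ≤ j → j < n → mu j ≤ mu i) (hM : ∀ i < n, mu i ≤ M)
    (htop : ∀ k i, k + 1 = n → i < n → N k i = mu i)
    (hstep : ∀ k i, i ≤ k → k + 1 < n → N (k + 1) i = N k i + A (k + 1) i)
    (hinter : ∀ k i, i ≤ k → k + 1 < n → N (k + 1) (i + 1) ≤ N k i) :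
    ∃ T : (Σ x : Fin M, Fin (columnHeight (n := n) mu x)) → Fin n,
      (∀ c, ∀ r r', r < r' → T ⟨c, r⟩ < T ⟨c, r'⟩) ∧
      ∀ k i : Fin n, i < k → tableauCount T k i = A k i := by
  have hmono : ∀ d k i, i ≤ k → k + d < n → N k i ≤ N (k + d) i := by
    intro d
    induction d with
    | zero => exact fun k i _ _ => le_rfl
    | succ d ih =>
      intro k i hik hk
      have h1 := ih k i hik (by omega)
      have h2 := hstep (k + d) i (by omega) (by omega)
      rw [← add_assoc]
      omega
  -- The letter in a box will be the first `k` for which the shape with row lengths `N k` contains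
  -- the box; the shape has only the rows up to `k`.
  have hex : ∀ s : Σ x : Fin M, Fin (columnHeight (n := n) mu x),
      ∃ k, k < n ∧ (s.2 : ℕ) ≤ k ∧ (s.1 : ℕ) < N k s.2 := by
    rintro ⟨x, r⟩
    have h1 := (lt_columnHeight hmu).1 r.2
    exact ⟨n - 1, by omega, by simp only; omega, by
      rw [htop (n - 1) r (by omega) h1.1]
      exact h1.2⟩
  refine ⟨fun s => ⟨Nat.find (hex s), (Nat.find_spec (hex s)).1⟩, fun c r r' hr => ?_,
    fun k i hik => ?_⟩
  · rw [Fin.lt_def] at hr ⊢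
    obtain ⟨h1, h2, h3⟩ := Nat.find_spec (hex ⟨c, r'⟩)
    set t := Nat.find (hex ⟨c, r'⟩)
    simp only at h2 h3
    -- By interlacing, a box of the shape `t` moved up one place in its column lies in the shape `t
    -- - 1`. So letters drop by at least one per step upwards.
    have hdiag : ∀ d : ℕ, d ≤ r' → (c : ℕ) < N (t - d) (r' - d) := by
      intro d
      induction d with
      | zero => exact fun _ => h3
      | succ d ih =>
        intro hd
        have h4 := ih (by omega)
        have h5 := hinter (t - (d + 1)) (r' - (d + 1)) (by omega) (by omega)
        rw [show t - (d + 1) + 1 = t - d by omega, show (r' : ℕ) - (d + 1) + 1 = r' - d by omega]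
          at h5
        omega
    have h6 := hdiag (r' - r) (by omega)
    rw [show (r' : ℕ) - (r' - r) = r by omega] at h6
    have h7 := Nat.find_min' (hex ⟨c, r⟩) (m := t - (r' - r))
      ⟨by omega, by simp only; omega, h6⟩
    simp only
    omega
  · obtain ⟨k, hk⟩ := k
    rw [Fin.lt_def] at hik
    simp only at hik ⊢
    obtain ⟨k, rfl⟩ : ∃ l, k = l + 1 := ⟨k - 1, by omega⟩
    have hN := hstep k i (by omega) hk
    have hNM : N (k + 1) i ≤ mu i := by
      rw [← htop (n - 1) i (by omega) i.2]
      have := hmono (n - 1 - (k + 1)) (k + 1) i (by omega) (by omega)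
      rwa [show k + 1 + (n - 1 - (k + 1)) = n - 1 by omega] at this
    have hMi := hM i i.2
    rw [show A (k + 1) i = (Finset.Ico (N k i) (N (k + 1) i)).card by rw [Nat.card_Ico]; omega]
    have hiff : ∀ s : Σ x : Fin M, Fin (columnHeight (n := n) mu x), (s.2 : ℕ) = i →
        (Nat.find (hex s) = k + 1 ↔ N k i ≤ s.1 ∧ (s.1 : ℕ) < N (k + 1) i) := by
      intro s hs
      rw [Nat.find_eq_iff, hs]
      constructor
      · rintro ⟨⟨-, -, h1⟩, h2⟩
        have := h2 k (by omega)
        refine ⟨?_, h1⟩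
        by_contra hc
        exact this ⟨by omega, by omega, by omega⟩
      · rintro ⟨h1, h2⟩
        refine ⟨⟨hk, by omega, h2⟩, fun l hl => ?_⟩
        rintro ⟨-, h3, h4⟩
        have := hmono (k - l) l i h3 (by omega)
        rw [show l + (k - l) = k by omega] at this
        omega
    refine Finset.card_bij (fun s _ => (s.1 : ℕ)) ?_ ?_ ?_
    · intro s hs
      simp only [Finset.mem_filter, Finset.mem_univ, true_and, Fin.mk.injEq] at hs
      exact Finset.mem_Ico.2 ((hiff s hs.2).1 hs.1)
    · rintro ⟨x, r⟩ hs ⟨x', r'⟩ hs' h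
      simp only [Finset.mem_filter, Finset.mem_univ, true_and] at hs hs'
      obtain rfl : x = x' := Fin.ext h
      obtain rfl : r = r' := Fin.ext (hs.2.trans hs'.2.symm)
      rfl
    · intro x hx
      have hx' := Finset.mem_Ico.1 hx
      have hxi : (i : ℕ) < columnHeight (n := n) mu (⟨x, by omega⟩ : Fin M) :=
        (lt_columnHeight hmu).2 ⟨i.2, by simp only; omega⟩
      refine ⟨⟨⟨x, by omega⟩, ⟨i, hxi⟩⟩, ?_, rfl⟩
      simp only [Finset.mem_filter, Finset.mem_univ, true_and, Fin.mk.injEq, and_true]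
      exact (hiff ⟨⟨x, by omega⟩, ⟨i, hxi⟩⟩ rfl).2 hx'

end PatternTableau

/-! ### Basis property and triangularity for the module -/

section Main

variable {n : ℕ} {lam : Fin n → ℂ}

/-- Subtracting `c` turns `lam` into a partition, whose column lengths are the exterior degrees; `c`
returns as the twist by the trace. -/
theorem exists_columnVector (hlam : IsDominant lam) :
    ∃ (c : ℂ) (M : ℕ) (m : Fin M → ℕ),
      (∀ i : Fin n, twistedE (Σ x, Fin (m x)) c i i (columnVector n m) =
        lam i • columnVector n m) ∧
      ∀ P : Pattern lam, ∃ T : (Σ x, Fin (m x)) → Fin n,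
        (∀ x, ∀ r r' : Fin (m x), r < r' → T ⟨x, r⟩ < T ⟨x, r'⟩) ∧
        arrKey (tableauCount T) = arrKey P.diff := by
  obtain ⟨c, hc, hP⟩ := exists_isNat_entry_sub hlam
  let mu : ℕ → ℕ := fun i => if h : i < n then toNat (lam ⟨i, h⟩ - c) else 0
  have hmu_cast : ∀ i : Fin n, ((mu i : ℕ) : ℂ) = lam i - c := fun i => by
    simp only [mu, dif_pos i.2]
    exact natCast_toNat (hc i)
  have hmu : ∀ i j, i ≤ j → j < n → mu j ≤ mu i := by
    intro i j hij hj
    obtain ⟨d, hd⟩ := isNat_sub_of_le hlam.isNat hij hj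
    rw [extendWeight, extendWeight, dif_pos (show i < n by omega), dif_pos hj] at hd
    have h1 := hmu_cast ⟨i, by omega⟩
    have h2 := hmu_cast ⟨j, hj⟩
    have h3 : ((mu i : ℕ) : ℂ) = ((mu j + d : ℕ) : ℂ) := by
      push_cast
      linear_combination h1 - h2 + hd
    have := Nat.cast_injective h3
    omega
  -- Any common bound of the `mu i` would do, since superfluous columns have height zero.
  let M := ∑ i ∈ Finset.range n, mu i
  have hM : ∀ i < n, mu i ≤ M := fun i hi =>
    Finset.single_le_sum (f := mu) (fun _ _ => Nat.zero_le _) (Finset.mem_range.2 hi)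
  refine ⟨c, M, fun x => columnHeight (n := n) mu x, fun i => ?_, fun P => ?_⟩
  · rw [twistedE, if_pos rfl, LinearMap.add_apply, wordE_columnVector le_rfl, if_pos rfl,
      LinearMap.smul_apply, Module.End.one_apply, ← add_smul]
    congr 1
    have hcard : (Finset.univ.filter fun x : Fin M => (i : ℕ) < columnHeight (n := n) mu x).card =
        mu i := by
      simp only [lt_columnHeight hmu, i.2, true_and]
      have := Fin.card_filter_val_lt (n := M) (m := mu i)
      rw [this]
      exact min_eq_right (hM i i.2)
    rw [hcard, hmu_cast, sub_add_cancel]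
  · let N : ℕ → ℕ → ℕ := ofFin fun k i => toNat (P.entry k i - c)
    have hN : ∀ (k i : ℕ) (hk : k < n) (hi : i ≤ k),
        ((N k i : ℕ) : ℂ) = P.entry ⟨k, hk⟩ ⟨i, by omega⟩ - c := fun k i hk hi => by
      simp only [N]
      rw [ofFin_apply _ hk (by omega)]
      exact natCast_toNat (hP P _ _ hi)
    have htop : ∀ k i, k + 1 = n → i < n → N k i = mu i := by
      intro k i hk hi
      have h1 := hN k i (by omega) (by omega)
      rw [P.top _ _ hk, ← hmu_cast] at h1
      exact Nat.cast_injective h1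
    have hstep : ∀ k i, i ≤ k → k + 1 < n → N (k + 1) i = N k i + ofFin P.diff (k + 1) i := by
      intro k i hik hk
      have h1 := hN k i (by omega) hik
      have h2 := hN (k + 1) i hk (by omega)
      have h3 := P.natCast_diff (k := ⟨k + 1, hk⟩) (i := ⟨i, by omega⟩)
        (by rw [Fin.lt_def]; simp only; omega)
      rw [ofFin_apply _ hk (by omega)]
      simp only [Nat.add_sub_cancel] at h3
      have h4 : ((N (k + 1) i : ℕ) : ℂ) =
          ((N k i + P.diff ⟨k + 1, hk⟩ ⟨i, by omega⟩ : ℕ) : ℂ) := by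
        push_cast
        rw [h1, h2, h3]
        ring
      exact Nat.cast_injective h4
    have hinter : ∀ k i, i ≤ k → k + 1 < n → N (k + 1) (i + 1) ≤ N k i := by
      intro k i hik hk
      have h1 := hN k i (by omega) hik
      have h2 := hN (k + 1) (i + 1) hk (by omega)
      obtain ⟨d, hd⟩ := (P.between ⟨k + 1, hk⟩ ⟨k, by omega⟩ ⟨i, by omega⟩ ⟨i + 1, by omega⟩ rfl rfl
        (by rw [Fin.le_def]; simp only; omega)).2
      have h4 : ((N k i : ℕ) : ℂ) = ((N (k + 1) (i + 1) + d : ℕ) : ℂ) := by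
        push_cast
        linear_combination h1 - h2 + hd
      have := Nat.cast_injective h4
      omega
    obtain ⟨T, hT, hcount⟩ := exists_tableau hmu hM htop hstep hinter
    exact ⟨T, hT, arrKey_eq_iff.2 fun k i hik => by rw [hcount k i hik, ofFin_val]⟩

variable {V : Type*} [AddCommGroup V] [Module ℂ V] [LieRingModule (gl n) V]
  [LieModule ℂ (gl n) V] {v : V}

/-- Among the patterns with nonzero coefficient in a relation, take the one with the greatest key.
At its tableau all other terms of the transferred relation vanish. -/
theorem linearIndependent_monomialVector (hlam : IsDominant lam)
    (hv : IsHighestWeightVector lam v) :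
    LinearIndependent ℂ fun P : Pattern lam => monomialVector v P := by
  obtain ⟨c, M, m, hweight, htab⟩ := exists_columnVector hlam
  rw [linearIndependent_iff']
  intro s g hsum
  by_contra! hne
  have h0 := monomial_sum_eq_zero (S := Σ x, Fin (m x)) hv
    (fun i j hij => by rw [wordE_columnVector hij.le, if_neg hij.ne, zero_smul]) hweight s g
    (fun P => P.diff) hsum
  obtain ⟨P, hP, hmax⟩ := Finset.exists_max_image (s.filter fun P => g P ≠ 0)
    (fun P => arrKey P.diff) (by
      obtain ⟨P, hP, hP0⟩ := hne
      exact ⟨P, Finset.mem_filter.2 ⟨hP, hP0⟩⟩)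
  obtain ⟨hPs, hP0⟩ := Finset.mem_filter.1 hP
  obtain ⟨T, hT, hkey⟩ := htab P
  have h1 := congrFun h0 T
  rw [Finset.sum_apply, Finset.sum_eq_single P] at h1
  · exact mul_ne_zero hP0 (monomial_columnVector_ne_zero hT hkey.symm) h1
  · intro Q hQ hQP
    by_cases hQ0 : g Q = 0
    · simp [hQ0]
    · have h2 := hmax Q (Finset.mem_filter.2 ⟨hQ, hQ0⟩)
      have h3 : arrKey Q.diff < arrKey P.diff :=
        lt_of_le_of_ne h2 fun h => hQP (Pattern.arrKey_injective h)
      rw [← hkey] at h3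
      simp only [Pi.smul_apply, monomial_columnVector_eq_zero hT h3, smul_zero]
  · exact fun h => absurd hPs h

theorem monomialVector_eq_arrProd (P : Pattern lam) :
    monomialVector v P = arrProd (ofFin (E (n := n) V)) n (ofFin P.diff) v := by
  rw [monomialVector, orderedProd_pow]

theorem gtVector_eq_arrProd (P : Pattern lam) :
    gtVector v P = arrProd (ofFin (lowering (n := n) V)) n (ofFin P.diff) v := by
  rw [gtVector, orderedProd_pow]

theorem monoSpan_le_span_monomialVector {Φ : (ℕ → ℕ → ℕ) → Prop} {Ψ : Pattern lam → Prop}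
    (h : ∀ A, Φ A → ∀ P : Pattern lam, (∀ k i : Fin n, i < k → P.diff k i = A k i) → Ψ P) :
    monoSpan (ofFin (E (n := n) V)) n (extendWeight lam) v Φ ≤
      Submodule.span ℂ (monomialVector v '' {P : Pattern lam | Ψ P}) := by
  refine Submodule.span_le.2 ?_
  rintro x ⟨A, hA, hΦ, rfl⟩
  obtain ⟨P, hP⟩ := exists_pattern_of_adm hA
  refine Submodule.subset_span ⟨P, h A hΦ P hP, ?_⟩
  rw [monomialVector_eq_arrProd]
  refine congrArg (fun f : Module.End ℂ V => f v) (arrProd_congr (fun _ _ _ _ => rfl) ?_)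
  intro r hr i hi
  rw [ofFin_apply _ hr (by omega)]
  exact hP _ _ hi

variable [FiniteDimensional ℂ V]

theorem span_monomialVector [LieModule.IsIrreducible ℂ (gl n) V] (hlam : IsDominant lam)
    (hv : IsHighestWeightVector lam v) :
    ⊤ ≤ Submodule.span ℂ (Set.range fun P : Pattern lam => monomialVector v P) := by
  have h1 := levelHull_le_monoSpan (isGl_E V) le_rfl isStable_bot
    (hv.isSingular (extendWeight_val lam)) hlam.isNat
  rw [eq_top_of_isStable levelHull_isStable (subset_levelHull (Set.mem_singleton v)) hv.ne_zero,
    bot_sup_eq] at h1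
  refine h1.trans ((monoSpan_le_span_monomialVector (Ψ := fun _ => True)
    fun _ _ _ _ => trivial).trans ?_)
  exact Submodule.span_mono (Set.image_subset_range _ _)

theorem gtVector_triangular (hlam : IsDominant lam) (hv : IsHighestWeightVector lam v)
    (P : Pattern lam) : ∃ r : ℂ, r ≠ 0 ∧ gtVector v P - r • monomialVector v P ∈
      Submodule.span ℂ (monomialVector v '' {Q : Pattern lam | arrKey Q.diff < arrKey P.diff}) := by
  obtain ⟨r, hr, h1⟩ := lowering_triangular (isGl_E V) isLowering_lowering le_rfl isStable_bot
    (hv.isSingular (extendWeight_val lam)) hlam.isNat P.adm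
  refine ⟨r, hr, ?_⟩
  rw [bot_sup_eq, ← gtVector_eq_arrProd, ← monomialVector_eq_arrProd] at h1
  refine monoSpan_le_span_monomialVector (fun A hA Q hQ => ?_) h1
  refine arrKey_lt_of_arrLt ?_
  obtain ⟨l, hl, ⟨i, hi, hlt, heq⟩, h2⟩ := hA
  have hQ' : ∀ k i, k < n → i < k → ofFin Q.diff k i = A k i := fun k i hk hi => by
    rw [ofFin_apply _ hk (by omega)]
    exact hQ _ _ hi
  refine ⟨l, hl, ⟨i, hi, ?_, fun j hj => ?_⟩, fun s hs hs' j hj => ?_⟩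
  · rwa [hQ' l i hl hi]
  · rw [hQ' l j hl (by omega), heq j hj]
  · rw [hQ' s j hs' hj, h2 s hs hs' j hj]

end Main

end GelfandTsetlin

end

theorem theoremA {n : ℕ} (lam : Fin n → ℂ) (hlam : GelfandTsetlin.IsDominant lam)
    (V : Type*) [AddCommGroup V] [Module ℂ V] [FiniteDimensional ℂ V]
    [LieRingModule (GelfandTsetlin.gl n) V] [LieModule ℂ (GelfandTsetlin.gl n) V]
    [LieModule.IsIrreducible ℂ (GelfandTsetlin.gl n) V]
    (v : V) (hv : GelfandTsetlin.IsHighestWeightVector lam v) :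
    (∃ (o : LinearOrder (GelfandTsetlin.Pattern lam))
      (d : GelfandTsetlin.Pattern lam → GelfandTsetlin.Pattern lam →₀ ℂ),
      ∀ P : GelfandTsetlin.Pattern lam,
        GelfandTsetlin.gtVector v P =
          (d P).sum (fun Q c => c • GelfandTsetlin.monomialVector v Q) ∧
        (∀ Q : GelfandTsetlin.Pattern lam, d P Q ≠ 0 → o.le P Q) ∧
        d P P ≠ 0) ∧
    (∃ b : Module.Basis (GelfandTsetlin.Pattern lam) ℂ V,
      ∀ P : GelfandTsetlin.Pattern lam, b P = GelfandTsetlin.monomialVector v P) := by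
  -- The order of keys is reversed, because the terms following the leading one have smaller keys.
  refine ⟨⟨LinearOrder.lift' (fun P : GelfandTsetlin.Pattern lam =>
    OrderDual.toDual (GelfandTsetlin.arrKey P.diff))
    (OrderDual.toDual.injective.comp GelfandTsetlin.Pattern.arrKey_injective), ?_⟩, ?_⟩
  · choose r hr h1 using GelfandTsetlin.gtVector_triangular (V := V) hlam hv
    simp only [Finsupp.mem_span_image_iff_linearCombination] at h1
    choose l hl hlv using h1
    have hl' : ∀ P Q, l P Q ≠ 0 →
        GelfandTsetlin.arrKey Q.diff < GelfandTsetlin.arrKey P.diff := fun P Q hQ =>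
      (Finsupp.mem_supported ℂ (l P)).1 (hl P) (Finsupp.mem_support_iff.2 hQ)
    refine ⟨fun P => Finsupp.single P (r P) + l P, fun P => ⟨?_, fun Q hQ => ?_, ?_⟩⟩
    · rw [← Finsupp.linearCombination_apply, map_add, Finsupp.linearCombination_single, hlv]
      abel
    · change GelfandTsetlin.arrKey Q.diff ≤ GelfandTsetlin.arrKey P.diff
      by_cases hPQ : P = Q
      · rw [hPQ]
      · refine (hl' P Q fun h0 => hQ ?_).le
        rw [Finsupp.add_apply, Finsupp.single_eq_of_ne (Ne.symm hPQ), h0, add_zero]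
    · have h0 : l P P = 0 := by
        by_contra hc
        exact lt_irrefl _ (hl' P P hc)
      rw [Finsupp.add_apply, Finsupp.single_eq_same, h0, add_zero]
      exact hr P
  · exact ⟨Module.Basis.mk (GelfandTsetlin.linearIndependent_monomialVector hlam hv)
      (GelfandTsetlin.span_monomialVector hlam hv), fun P => Module.Basis.mk_apply _ _ P⟩
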